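/- Conventions. All Banach lattices are real, $m\in\mathbb N$, and $S_m$ is the set of permutations of $\{1,\dots,m\}$. For a Banach lattice $E$, the dual $E^*$ and the bidual $E^{**}$ are Banach lattices with the dual norm and the dual order. Let $E_1,\dots,E_m,F$ be Banach lattices. An $m$-linear operator $A\colon E_1\times\cdots\times E_m\to F$ is *positive* if $A(x_1,\dots,x_m)\ge 0$ whenever $x_1,\dots,x_m\ge 0$, and *regular* if it is the difference of two positive $m$-linear operators (it is then continuous). A *Riesz multimorphism* is a regular $m$-linear operator $A$ with $|A(x_1,\dots,x_m)|=A(|x_1|,\dots,|x_m|)$ for all $x_1\in E_1,\dots,x_m\in E_m$. It has *finite rank* if the vector sublattice of $F$ generated by its range is finite dimensional. A Banach lattice has *order continuous norm* if $\|x_\alpha\|\to 0$ for every net $x_\alpha\downarrow 0$. For $\rho\in S_m$ and a continuous $m$-linear operator $A\colon E_1\times\cdots\times E_m\to F$, the *Aron–Berner extension* $AB_m^\rho(A)\colon E_1^{**}\times\cdots\times E_m^{**}\to F^{**}$ is the $m$-linear operator $$AB_m^\rho(A)(x_1^{**},\dots,x_m^{**})(y^*)=\big(\overline{x_{\rho(m)}^{**}}\circ\cdots\circ\overline{x_{\rho(1)}^{**}}\big)(y^*\circ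 A),\qquad y^*\in F^*,$$ where $\overline{x_{\rho(k)}^{**}}$ sends a continuous multilinear form $B$ in the variables $x_j\in E_j$, $j\in\{1,\dots,m\}\setminus\{\rho(1),\dots,\rho(k-1)\}$, to the form in the variables $x_j$, $j\in\{1,\dots,m\}\setminus\{\rho(1),\dots,\rho(k)\}$, obtained by applying $x_{\rho(k)}^{**}$ to the functional $x_{\rho(k)}\mapsto B$ on $E_{\rho(k)}$, the other variables being fixed. **Proposition 3.4.** Let $E_1,\dots,E_m,F$ be Banach lattices. (a) If $A\colon E_1\times\cdots\times E_m\to F$ is a finite rank Riesz multimorphism, then its Aron–Berner extensions $AB_m^\rho(A)\colon E_1^{**}\times\cdots\times E_m^{**}\to F^{**}$, $\rho\in S_m$, all coincide and are Riesz multimorphisms. (b) If $E_1^*,\dots,E_m^*$ have order continuous norms and $A\colon E_1\times\cdots\times E_m\to F$ is a Riesz multimorphism, then, for every $\rho\in S_m$, the Aron–Berner extension $AB_m^\rho(A)\colon E_1^{**}\times\cdots\times E_m^{**}\to F^{**}$ is a Riesz multimorphism. -/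

import Mathlib

universe u v

/-- Real Banach lattices: complete normed vector lattices with a lattice (solid) norm. -/
class IsBanachLattice (E : Type u) [NormedAddCommGroup E] [NormedSpace ℝ E] [Lattice E] : Prop
    extends IsOrderedAddMonoid E, IsOrderedModule ℝ E, HasSolidNorm E, CompleteSpace E

/-! ### The dual Banach lattice -/

namespace DualLattice

variable {E : Type u} [NormedAddCommGroup E] [NormedSpace ℝ E] [Lattice E] [IsBanachLattice E]

/-- The values of `φ` on the order interval `[0, x]`. -/
def vals (φ : StrongDual ℝ E) (x : E) : Set ℝ := φ '' Set.Icc 0 x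

/-- The Riesz-Kantorovich formula for `φ⁺ x`, where `0 ≤ x`. -/
noncomputable def pos (φ : StrongDual ℝ E) (x : E) : ℝ := sSup (vals φ x)

lemma norm_le_of_mem {x y : E} (hy : y ∈ Set.Icc 0 x) : ‖y‖ ≤ ‖x‖ := by
  apply HasSolidNorm.solid
  rw [abs_of_nonneg hy.1, abs_of_nonneg (hy.1.trans hy.2)]
  exact hy.2

lemma vals_le (φ : StrongDual ℝ E) {x : E} {r : ℝ} (hr : r ∈ vals φ x) : r ≤ ‖φ‖ * ‖x‖ := by
  obtain ⟨y, hy, rfl⟩ := hr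
  refine (le_abs_self _).trans ((φ.le_opNorm y).trans ?_)
  exact mul_le_mul_of_nonneg_left (norm_le_of_mem hy) (norm_nonneg _)

lemma bddAbove_vals (φ : StrongDual ℝ E) (x : E) : BddAbove (vals φ x) :=
  ⟨_, fun _ hr => vals_le φ hr⟩

lemma vals_nonempty (φ : StrongDual ℝ E) {x : E} (hx : 0 ≤ x) : (vals φ x).Nonempty :=
  ⟨_, 0, ⟨le_rfl, hx⟩, rfl⟩

lemma le_pos (φ : StrongDual ℝ E) {x y : E} (hy : y ∈ Set.Icc 0 x) : φ y ≤ pos φ x :=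
  le_csSup (bddAbove_vals φ x) ⟨y, hy, rfl⟩

lemma pos_nonneg (φ : StrongDual ℝ E) {x : E} (hx : 0 ≤ x) : 0 ≤ pos φ x := by
  simpa using le_pos φ (x := x) (y := 0) ⟨le_rfl, hx⟩

lemma pos_le (φ : StrongDual ℝ E) {x : E} (hx : 0 ≤ x) {c : ℝ}
    (h : ∀ y, 0 ≤ y → y ≤ x → φ y ≤ c) : pos φ x ≤ c := by
  apply csSup_le (vals_nonempty φ hx)
  rintro _ ⟨y, hy, rfl⟩
  exact h y hy.1 hy.2

lemma pos_add (φ : StrongDual ℝ E) {a b : E} (ha : 0 ≤ a) (hb : 0 ≤ b) :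
    pos φ (a + b) = pos φ a + pos φ b := by
  apply le_antisymm
  · apply pos_le φ (add_nonneg ha hb)
    intro y hy hy'
    have h1 : φ (y ⊓ a) ≤ pos φ a := le_pos φ ⟨le_inf hy ha, inf_le_right⟩
    have h2 : φ (y - y ⊓ a) ≤ pos φ b := by
      refine le_pos φ ⟨sub_nonneg.2 inf_le_left, ?_⟩
      rw [sub_le_comm]
      exact le_inf (sub_le_self _ hb) (sub_le_iff_le_add.2 hy')
    have h3 : φ y = φ (y ⊓ a) + φ (y - y ⊓ a) := by rw [← map_add]; simp
    linarith
  · rw [← le_sub_iff_add_le]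
    apply pos_le φ ha
    intro y hy hy'
    rw [le_sub_comm]
    apply pos_le φ hb
    intro z hz hz'
    have := le_pos φ (x := a + b) (y := y + z) ⟨add_nonneg hy hz, add_le_add hy' hz'⟩
    rw [map_add] at this
    linarith

/-- The additive extension of `pos φ` from the positive cone to `E`. -/
noncomputable def posExt (φ : StrongDual ℝ E) (x : E) : ℝ := pos φ x⁺ - pos φ x⁻

lemma posExt_eq (φ : StrongDual ℝ E) {x a b : E} (ha : 0 ≤ a) (hb : 0 ≤ b) (h : x = a - b) :
    posExt φ x = pos φ a - pos φ b := by
  have h1 : x⁺ + b = a + x⁻ := by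
    have := posPart_sub_negPart x
    rw [sub_eq_iff_eq_add] at this
    rw [this, h]; abel
  have h2 := congrArg (pos φ) h1
  rw [pos_add φ (posPart_nonneg x) hb, pos_add φ ha (negPart_nonneg x)] at h2
  unfold posExt
  linarith

lemma posExt_of_nonneg (φ : StrongDual ℝ E) {x : E} (hx : 0 ≤ x) : posExt φ x = pos φ x := by
  rw [posExt_eq φ hx le_rfl (sub_zero x).symm]
  have : pos φ (0 : E) = 0 := by
    have := pos_add φ (le_refl (0 : E)) le_rfl
    simp only [add_zero] at this
    linarith
  rw [this, sub_zero]

lemma posExt_add (φ : StrongDual ℝ E) (x y : E) : posExt φ (x + y) = posExt φ x + posExt φ y := by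
  rw [posExt_eq φ (add_nonneg (posPart_nonneg x) (posPart_nonneg y))
    (add_nonneg (negPart_nonneg x) (negPart_nonneg y)),
    pos_add φ (posPart_nonneg x) (posPart_nonneg y),
    pos_add φ (negPart_nonneg x) (negPart_nonneg y)]
  · unfold posExt; ring
  · conv_lhs => rw [← posPart_sub_negPart x, ← posPart_sub_negPart y]
    abel

lemma abs_posExt_le (φ : StrongDual ℝ E) (x : E) : |posExt φ x| ≤ ‖φ‖ * ‖x‖ := by
  have hb : ∀ z : E, 0 ≤ z → z ≤ |x| → pos φ z ≤ ‖φ‖ * ‖x‖ := fun z hz hzx => by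
    apply pos_le φ hz
    intro y hy hy'
    refine (vals_le φ (x := |x|) ⟨y, ⟨hy, hy'.trans hzx⟩, rfl⟩).trans ?_
    rw [norm_abs_eq_norm]
  have h1 := hb x⁺ (posPart_nonneg x) (sup_le (le_abs_self x) (abs_nonneg x))
  have h2 := hb x⁻ (negPart_nonneg x) (sup_le (neg_le_abs x) (abs_nonneg x))
  have h3 := pos_nonneg φ (posPart_nonneg x)
  have h4 := pos_nonneg φ (negPart_nonneg x)
  unfold posExt
  rw [abs_le]
  constructor <;> linarith

/-- The positive part `φ⁺` of a functional in the dual. -/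
noncomputable def posDual (φ : StrongDual ℝ E) : StrongDual ℝ E :=
  AddMonoidHom.toRealLinearMap (AddMonoidHom.mk' (posExt φ) (posExt_add φ))
    (AddMonoidHomClass.continuous_of_bound _ ‖φ‖ (abs_posExt_le φ))

lemma posDual_apply (φ : StrongDual ℝ E) {x : E} (hx : 0 ≤ x) : posDual φ x = pos φ x :=
  posExt_of_nonneg φ hx

/-- The dual `E*` of a Banach lattice with its usual order: `φ ≤ ψ` if and only if `φ x ≤ ψ x` for
all `x ≥ 0`. Finite suprema and infima are given by the Riesz-Kantorovich formulas. -/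
noncomputable instance instLattice : Lattice (StrongDual ℝ E) where
  le φ ψ := ∀ x : E, 0 ≤ x → φ x ≤ ψ x
  le_refl _ _ _ := le_rfl
  le_trans _ _ _ h h' x hx := (h x hx).trans (h' x hx)
  le_antisymm φ ψ h h' := by
    ext x
    have h1 := (h _ (posPart_nonneg x)).antisymm (h' _ (posPart_nonneg x))
    have h2 := (h _ (negPart_nonneg x)).antisymm (h' _ (negPart_nonneg x))
    rw [← posPart_sub_negPart x, map_sub, map_sub, h1, h2]
  sup φ ψ := φ + posDual (ψ - φ)
  le_sup_left φ ψ x hx := by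
    have := pos_nonneg (ψ - φ) hx
    simp only [add_apply, posDual_apply _ hx]
    linarith
  le_sup_right φ ψ x hx := by
    have := le_pos (ψ - φ) (x := x) ⟨hx, le_rfl⟩
    simp only [add_apply, posDual_apply _ hx]
    simp only [sub_apply] at this
    linarith
  sup_le φ ψ χ h h' x hx := by
    simp only [add_apply, posDual_apply _ hx]
    rw [← le_sub_iff_add_le']
    apply pos_le _ hx
    intro y hy hyx
    have h1 := h' y hy
    have h2 := h (x - y) (sub_nonneg.2 hyx)
    simp only [map_sub] at h2
    simp only [sub_apply]
    linarith
  inf φ ψ := φ - posDual (φ - ψ)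
  inf_le_left φ ψ x hx := by
    have := pos_nonneg (φ - ψ) hx
    simp only [sub_apply, posDual_apply _ hx]
    linarith
  inf_le_right φ ψ x hx := by
    have := le_pos (φ - ψ) (x := x) ⟨hx, le_rfl⟩
    simp only [sub_apply, posDual_apply _ hx] at this ⊢
    linarith
  le_inf χ φ ψ h h' x hx := by
    simp only [sub_apply, posDual_apply _ hx]
    rw [le_sub_comm]
    apply pos_le _ hx
    intro y hy hyx
    have h1 := h' y hy
    have h2 := h (x - y) (sub_nonneg.2 hyx)
    simp only [map_sub] at h2
    simp only [sub_apply]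
    linarith

lemma le_iff {φ ψ : StrongDual ℝ E} : φ ≤ ψ ↔ ∀ x : E, 0 ≤ x → φ x ≤ ψ x := Iff.rfl

lemma sup_apply (φ ψ : StrongDual ℝ E) {x : E} (hx : 0 ≤ x) :
    (φ ⊔ ψ) x = φ x + sSup ((ψ - φ) '' Set.Icc 0 x) :=
  congrArg (φ x + ·) (posDual_apply (ψ - φ) hx)

instance instIsOrderedAddMonoid : IsOrderedAddMonoid (StrongDual ℝ E) where
  add_le_add_left φ ψ h χ := by
    intro x hx
    have := h x hx
    simp only [add_apply]
    linarith

lemma abs_apply_le (φ : StrongDual ℝ E) (x : E) : |φ x| ≤ |φ| |x| := by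
  have h : ∀ z : E, 0 ≤ z → |φ z| ≤ |φ| z := fun z hz => by
    have h1 := le_iff.1 (le_abs_self φ) z hz
    have h2 := le_iff.1 (neg_le_abs φ) z hz
    simp only [neg_apply] at h2
    rw [abs_le]
    constructor <;> linarith
  calc |φ x| = |φ x⁺ - φ x⁻| := by rw [← map_sub, posPart_sub_negPart]
    _ ≤ |φ x⁺| + |φ x⁻| := abs_sub _ _
    _ ≤ |φ| x⁺ + |φ| x⁻ := add_le_add (h _ (posPart_nonneg x)) (h _ (negPart_nonneg x))
    _ = |φ| |x| := by rw [← map_add, posPart_add_negPart]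

lemma abs_apply_le_norm (φ : StrongDual ℝ E) {x : E} (hx : 0 ≤ x) : |φ| x ≤ ‖φ‖ * ‖x‖ := by
  rw [abs, sup_apply φ (-φ) hx, ← le_sub_iff_add_le']
  apply csSup_le (vals_nonempty (-φ - φ) hx)
  rintro _ ⟨y, hy, rfl⟩
  have h1 : φ (x - y - y) ≤ ‖φ‖ * ‖x‖ := by
    refine (le_abs_self _).trans ((φ.le_opNorm _).trans ?_)
    apply mul_le_mul_of_nonneg_left _ (norm_nonneg _)
    apply HasSolidNorm.solid
    rw [abs_of_nonneg hx]
    refine sup_le ?_ ?_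
    rotate_left
    · rw [neg_le_iff_add_nonneg]
      have : x + (x - y - y) = (x - y) + (x - y) := by abel
      rw [this]
      exact add_nonneg (sub_nonneg.2 hy.2) (sub_nonneg.2 hy.2)
    · exact (sub_le_self _ hy.1).trans (sub_le_self _ hy.1)
  simp only [map_sub] at h1
  simp only [sub_apply, neg_apply]
  linarith

/-- The dual of a Banach lattice is a Banach lattice for the dual norm and the dual order. -/
instance instIsBanachLattice : IsBanachLattice (StrongDual ℝ E) where
  smul_le_smul_of_nonneg_left c hc φ ψ h x hx := mul_le_mul_of_nonneg_left (h x hx) hc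
  smul_le_smul_of_nonneg_right φ hφ c d h x hx := by
    have := le_iff.1 hφ x hx
    exact mul_le_mul_of_nonneg_right h this
  solid φ ψ h := by
    refine φ.opNorm_le_bound (norm_nonneg _) fun x => ?_
    calc ‖φ x‖ ≤ |φ| |x| := abs_apply_le φ x
      _ ≤ |ψ| |x| := h _ (abs_nonneg x)
      _ ≤ ‖ψ‖ * ‖|x|‖ := abs_apply_le_norm ψ (abs_nonneg x)
      _ = ‖ψ‖ * ‖x‖ := by rw [norm_abs_eq_norm]

end DualLattice

/-- The bidual `E** = (E*)*`. -/
abbrev Bidual (E : Type u) [NormedAddCommGroup E] [NormedSpace ℝ E] : Type u :=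
  StrongDual ℝ (StrongDual ℝ E)

/-- The norm of `E` is order continuous: `x_α ↓ 0` implies `‖x_α‖ → 0`. Decreasing nets are given as
downward directed sets. -/
def HasOrderContinuousNorm (E : Type u) [NormedAddCommGroup E] [Lattice E] : Prop :=
  ∀ D : Set E, D.Nonempty → DirectedOn (fun x y => y ≤ x) D → IsGLB D 0 →
    ∀ ε : ℝ, 0 < ε → ∃ d ∈ D, ∀ x ∈ D, x ≤ d → ‖x‖ < ε

/-- The Riesz subspace (vector sublattice) of `F` generated by `S`. -/
def rieszSpan {F : Type v} [AddCommGroup F] [Module ℝ F] [Lattice F] (S : Set F) :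
    Submodule ℝ F :=
  sInf {G | S ⊆ G ∧ ∀ x ∈ G, ∀ y ∈ G, x ⊔ y ∈ G ∧ x ⊓ y ∈ G}

/-! ### Regular multilinear operators and Riesz multimorphisms -/

namespace MultilinearMap

section

variable {ι : Type*} {E : ι → Type u} {F : Type v}
  [∀ i, AddCommGroup (E i)] [∀ i, Module ℝ (E i)] [∀ i, Lattice (E i)]
  [AddCommGroup F] [Module ℝ F] [Lattice F]

/-- Positive multilinear operators. -/
def IsPositive (A : MultilinearMap ℝ E F) : Prop :=
  ∀ x : ∀ i, E i, (∀ i, 0 ≤ x i) → 0 ≤ A x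

/-- Regular multilinear operators: differences of two positive ones. -/
def IsRegular (A : MultilinearMap ℝ E F) : Prop :=
  ∃ A₁ A₂ : MultilinearMap ℝ E F, A₁.IsPositive ∧ A₂.IsPositive ∧ A = A₁ - A₂

/-- Riesz multimorphisms: regular multilinear operators with `|A (x₁, …, xₘ)| = A (|x₁|, …, |xₘ|)`.
-/
structure IsRieszMultimorphism (A : MultilinearMap ℝ E F) : Prop where
  regular : A.IsRegular
  abs_map : ∀ x : ∀ i, E i, |A x| = A (fun i => |x i|)

/-- Finite rank: the Riesz subspace generated by the range is finite dimensional. -/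
def HasFiniteRank (A : MultilinearMap ℝ E F) : Prop :=
  FiniteDimensional ℝ (rieszSpan (Set.range A))

end

section

variable {ι : Type*} [Fintype ι] {E : ι → Type u} {F : Type v}
  [∀ i, NormedAddCommGroup (E i)] [∀ i, NormedSpace ℝ (E i)] [∀ i, Lattice (E i)]
  [∀ i, IsBanachLattice (E i)]
  [NormedAddCommGroup F] [NormedSpace ℝ F] [Lattice F] [IsBanachLattice F]

lemma IsPositive.mono {A : MultilinearMap ℝ E F} (hA : A.IsPositive) {x y : ∀ i, E i}
    (hx : ∀ i, 0 ≤ x i) (hxy : ∀ i, x i ≤ y i) : A x ≤ A y := by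
  classical
  suffices h : ∀ s : Finset ι, A x ≤ A (s.piecewise y x) by simpa using h Finset.univ
  intro s
  induction s using Finset.induction_on with
  | empty => simp
  | insert a s ha ih =>
    refine ih.trans ?_
    rw [Finset.piecewise_insert]
    set z := s.piecewise y x with hz
    have hza : z a = x a := by simp [hz, ha]
    have h1 : A (Function.update z a (y a)) =
        A z + A (Function.update z a (y a - x a)) := by
      conv_rhs => rw [← Function.update_eq_self a z, hza]
      rw [Function.update_idem, ← A.map_update_add]
      simp
    rw [h1]
    refine le_add_of_nonneg_right (hA _ fun i => ?_)
    by_cases hi : i = a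
    · subst hi; simpa using hxy i
    · rw [Function.update_of_ne hi, hz]
      by_cases his : i ∈ s
      · simpa [his] using (hx i).trans (hxy i)
      · simpa [his] using hx i

lemma IsPositive.abs_le {A : MultilinearMap ℝ E F} (hA : A.IsPositive) (x : ∀ i, E i) :
    |A x| ≤ A (fun i => |x i|) := by
  classical
  suffices h : ∀ (s : Finset ι) (x : ∀ i, E i), (∀ i ∉ s, 0 ≤ x i) → |A x| ≤ A (fun i => |x i|) from
    h Finset.univ x (by simp)
  intro s
  induction s using Finset.induction_on with
  | empty =>
    intro x hx
    have h : (fun i => |x i|) = x := funext fun i => abs_of_nonneg (hx i (by simp))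
    rw [h, abs_of_nonneg (hA x fun i => hx i (by simp))]
  | insert a s ha ih =>
    intro x hx
    have key : ∀ z : E a, 0 ≤ z →
        |A (Function.update x a z)| ≤ A (Function.update (fun i => |x i|) a z) := by
      intro z hz
      refine (ih (Function.update x a z) fun i hi => ?_).trans (le_of_eq ?_)
      · by_cases hia : i = a
        · subst hia; simpa using hz
        · rw [Function.update_of_ne hia]
          exact hx i (by simp [hia, hi])
      · congr 1
        ext i
        by_cases hia : i = a
        · subst hia; simp [abs_of_nonneg hz]
        · simp [Function.update_of_ne hia]
    have h1 : A x = A (Function.update x a (x a)⁺) - A (Function.update x a (x a)⁻) := by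
      rw [← A.map_update_sub, posPart_sub_negPart, Function.update_eq_self]
    have h2 : A (fun i => |x i|) = A (Function.update (fun i => |x i|) a (x a)⁺) +
        A (Function.update (fun i => |x i|) a (x a)⁻) := by
      rw [← A.map_update_add, posPart_add_negPart]
      congr 1
      ext i
      by_cases hia : i = a
      · subst hia; simp
      · simp [Function.update_of_ne hia]
    rw [h1, h2]
    rw [sub_eq_add_neg]
    refine (abs_add_le _ _).trans ?_
    rw [abs_neg]
    exact add_le_add (key _ (posPart_nonneg _)) (key _ (negPart_nonneg _))

lemma IsPositive.exists_bound {A : MultilinearMap ℝ E F} (hA : A.IsPositive) :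
    ∃ C : ℝ, ∀ x : ∀ i, E i, (∀ i, 0 ≤ x i) → (∀ i, ‖x i‖ ≤ 1) → ‖A x‖ ≤ C := by
  by_contra hcon
  push Not at hcon
  choose x hx0 hx1 hxA using fun n : ℕ => hcon (n * ((2 : ℝ) ^ n) ^ Fintype.card ι)
  have hsum : ∀ i, Summable fun n : ℕ => ((1 / 2 : ℝ) ^ n) • x n i := fun i => by
    refine Summable.of_norm_bounded summable_geometric_two fun n => ?_
    rw [norm_smul, norm_pow]
    have : ‖(1 / 2 : ℝ)‖ = 1 / 2 := by norm_num
    rw [this]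
    exact mul_le_of_le_one_right (by positivity) (hx1 n i)
  have hnn : ∀ n i, 0 ≤ ((1 / 2 : ℝ) ^ n) • x n i := fun n i =>
    smul_nonneg (by positivity) (hx0 n i)
  set z : ∀ i, E i := fun i => ∑' n : ℕ, ((1 / 2 : ℝ) ^ n) • x n i with hz
  have hle : ∀ n i, ((1 / 2 : ℝ) ^ n) • x n i ≤ z i := fun n i =>
    (hsum i).le_tsum n fun k _ => hnn k i
  obtain ⟨n, hn⟩ := exists_nat_gt ‖A z‖
  have h1 : A (fun i => ((1 / 2 : ℝ) ^ n) • x n i) ≤ A z := hA.mono (hnn n) (hle n)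
  have h2 : ‖A (fun i => ((1 / 2 : ℝ) ^ n) • x n i)‖ ≤ ‖A z‖ := by
    apply HasSolidNorm.solid
    have h0 := hA _ (hnn n)
    rw [abs_of_nonneg h0, abs_of_nonneg (h0.trans h1)]
    exact h1
  rw [A.map_smul_univ (fun _ => (1 / 2 : ℝ) ^ n), norm_smul] at h2
  simp only [Finset.prod_const, Finset.card_univ, norm_pow] at h2
  have h3 : ‖(1 / 2 : ℝ)‖ = 1 / 2 := by norm_num
  rw [h3] at h2
  have h4 := hxA n
  have h5 : (0 : ℝ) < ((1 / 2 : ℝ) ^ n) ^ Fintype.card ι := by positivity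
  have h6 := mul_lt_mul_of_pos_left h4 h5
  have h7 : ((1 / 2 : ℝ) ^ n) ^ Fintype.card ι * (n * ((2 : ℝ) ^ n) ^ Fintype.card ι) = n := by
    rw [mul_left_comm, ← mul_pow, ← mul_pow]; norm_num
  rw [h7] at h6
  linarith

/-- Positive multilinear operators between Banach lattices are automatically continuous. -/
lemma IsPositive.continuous {A : MultilinearMap ℝ E F} (hA : A.IsPositive) : Continuous A := by
  obtain ⟨C, hC⟩ := hA.exists_bound
  refine A.continuous_of_bound C fun x => ?_
  have h1 : ‖A x‖ ≤ ‖A (fun i => |x i|)‖ :=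
    HasSolidNorm.solid ((hA.abs_le x).trans (le_abs_self _))
  refine h1.trans ?_
  have h2 : (fun i => |x i|) = fun i => ‖x i‖ • (‖x i‖⁻¹ • |x i|) := by
    ext i
    by_cases hi : x i = 0
    · simp [hi]
    · rw [smul_smul, mul_inv_cancel₀ (norm_ne_zero_iff.2 hi), one_smul]
  rw [h2, A.map_smul_univ, norm_smul, mul_comm, norm_prod]
  simp only [norm_norm]
  refine mul_le_mul_of_nonneg_right (hC _ (fun i => ?_) fun i => ?_) (by positivity)
  · exact smul_nonneg (by positivity) (abs_nonneg _)
  · rw [norm_smul, norm_abs_eq_norm, norm_inv, norm_norm]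
    exact inv_mul_le_one

/-- A regular multilinear operator between Banach lattices, as a continuous multilinear operator
(continuity is automatic). -/
def IsRegular.toContinuous {A : MultilinearMap ℝ E F} (hA : A.IsRegular) :
    ContinuousMultilinearMap ℝ E F where
  toMultilinearMap := A
  cont := by
    obtain ⟨A₁, A₂, h₁, h₂, h⟩ := hA
    have h' : (A : (∀ i, E i) → F) = fun x => A₁ x - A₂ x := by rw [h]; rfl
    change Continuous A
    rw [h']
    exact h₁.continuous.sub h₂.continuous

end

end MultilinearMap

/-! ### Aron-Berner extensions -/

namespace AronBerner

/-- For `φ ∈ (E 0)**`, the operator sending an `(m+1)`-linear form `B` to the `m`-linear form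
`(x₁, …, xₘ) ↦ φ (t ↦ B (t, x₁, …, xₘ))`. -/
noncomputable def step {m : ℕ} {E : Fin (m + 1) → Type u} [∀ i, NormedAddCommGroup (E i)]
    [∀ i, NormedSpace ℝ (E i)] (φ : Bidual (E 0)) :
    ContinuousMultilinearMap ℝ E ℝ →L[ℝ] ContinuousMultilinearMap ℝ (fun i : Fin m => E i.succ) ℝ :=
  (ContinuousLinearMap.compContinuousMultilinearMapL ℝ (fun i : Fin m => E i.succ)
      (StrongDual ℝ (E 0)) ℝ φ) ∘L
    (ContinuousLinearMap.flipMultilinearEquiv ℝ (fun i : Fin m => E i.succ) (E 0) ℝ :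
      (E 0 →L[ℝ] ContinuousMultilinearMap ℝ (fun i : Fin m => E i.succ) ℝ) →L[ℝ]
        ContinuousMultilinearMap ℝ (fun i : Fin m => E i.succ) (E 0 →L[ℝ] ℝ)) ∘L
    ((continuousMultilinearCurryLeftEquiv ℝ E ℝ).toContinuousLinearEquiv :
      ContinuousMultilinearMap ℝ E ℝ →L[ℝ]
        (E 0 →L[ℝ] ContinuousMultilinearMap ℝ (fun i : Fin m => E i.succ) ℝ))

lemma step_apply {m : ℕ} {E : Fin (m + 1) → Type u} [∀ i, NormedAddCommGroup (E i)]
    [∀ i, NormedSpace ℝ (E i)] (φ : Bidual (E 0)) (B : ContinuousMultilinearMap ℝ E ℝ)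
    (x : ∀ i : Fin m, E i.succ) :
    step φ B x = φ (B.curryLeft.flipMultilinear x) := rfl

/-- The extension of multilinear forms in the natural order of the variables:
`extend m E (φ₀, …, φₘ₋₁) B = (step φₘ₋₁ ∘ ⋯ ∘ step φ₀) B`, so the first variable is extended first. It
is linear in `B` and multilinear in `(φ₀, …, φₘ₋₁)`. -/
noncomputable def extend : (m : ℕ) → (E : Fin m → Type u) → [∀ i, NormedAddCommGroup (E i)] →
    [∀ i, NormedSpace ℝ (E i)] →
    MultilinearMap ℝ (fun i => Bidual (E i)) (ContinuousMultilinearMap ℝ E ℝ →L[ℝ] ℝ)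
  | 0, E, _, _ => MultilinearMap.constOfIsEmpty ℝ _ (ContinuousMultilinearMap.apply ℝ E ℝ 0)
  | m + 1, E, _, _ => LinearMap.uncurryLeft
      { toFun := fun φ => MultilinearMap.mk'
          (fun ψ => (extend m (fun i => E i.succ) ψ) ∘L step φ)
          (by intros; ext; simp)
          (by intros; ext; simp)
        map_add' := by
          intros; ext; simp [step]
        map_smul' := by
          intros; ext; simp [step] }

lemma extend_zero (E : Fin 0 → Type u) [∀ i, NormedAddCommGroup (E i)] [∀ i, NormedSpace ℝ (E i)]
    (φ : ∀ i, Bidual (E i)) (B : ContinuousMultilinearMap ℝ E ℝ) : extend 0 E φ B = B 0 := rfl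

lemma extend_succ (m : ℕ) (E : Fin (m + 1) → Type u) [∀ i, NormedAddCommGroup (E i)]
    [∀ i, NormedSpace ℝ (E i)] (φ : ∀ i, Bidual (E i)) (B : ContinuousMultilinearMap ℝ E ℝ) :
    extend (m + 1) E φ B = extend m (fun i => E i.succ) (fun i => φ i.succ) (step (φ 0) B) := rfl

section

variable {m : ℕ} {E : Fin m → Type u} [∀ i, NormedAddCommGroup (E i)] [∀ i, NormedSpace ℝ (E i)]
  {F : Type v} [NormedAddCommGroup F] [NormedSpace ℝ F]

/-- `A` with its variables listed in the order `ρ 0, ρ 1, …`. -/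
def reindex (ρ : Equiv.Perm (Fin m)) (A : ContinuousMultilinearMap ℝ E F) :
    ContinuousMultilinearMap ℝ (fun j => E (ρ j)) F where
  toMultilinearMap := MultilinearMap.domDomCongrLinearEquiv' ℝ ℝ E F ρ.symm A.toMultilinearMap
  cont := A.cont.comp (Homeomorph.piCongrLeft (Y := E) ρ).continuous

lemma reindex_apply (ρ : Equiv.Perm (Fin m)) (A : ContinuousMultilinearMap ℝ E F)
    (x : ∀ i, E i) : reindex ρ A (fun j => x (ρ j)) = A x :=
  congrArg A ((Equiv.piCongrLeft' E ρ.symm).symm_apply_apply x)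

end

end AronBerner

section

variable {m : ℕ} {E : Fin m → Type u} [∀ i, NormedAddCommGroup (E i)] [∀ i, NormedSpace ℝ (E i)]
  {F : Type v} [NormedAddCommGroup F] [NormedSpace ℝ F]

/-- The Aron-Berner extension `AB^ρ(A) : E₁** × ⋯ × Eₘ** → F**` of `A : E₁ × ⋯ × Eₘ → F`: the value
of `AB^ρ(A)(x₁'', …, xₘ'')` at `y' ∈ F*` is obtained from the form `y' ∘ A` by applying `x''_{ρ(1)}`
in the variable `ρ(1)` (the others being fixed), then `x''_{ρ(2)}` in the variable `ρ(2)`, and so on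
up to `x''_{ρ(m)}`. -/
noncomputable def aronBerner (ρ : Equiv.Perm (Fin m)) (A : ContinuousMultilinearMap ℝ E F) :
    MultilinearMap ℝ (fun i => Bidual (E i)) (Bidual F) where
  toFun x := (AronBerner.extend m (fun j => E (ρ j)) (fun j => x (ρ j))) ∘L
    ((ContinuousLinearMap.compContinuousMultilinearMapL ℝ (fun j => E (ρ j)) F ℝ).flip
      (AronBerner.reindex ρ A))
  map_update_add' := by
    intro _ x i φ ψ
    rw [← ContinuousLinearMap.add_comp]
    exact congrArg (· ∘L _) (((MultilinearMap.domDomCongrLinearEquiv' ℝ ℝ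
      (fun i => Bidual (E i)) _ ρ.symm).symm
        (AronBerner.extend m (fun j => E (ρ j)))).map_update_add x i φ ψ)
  map_update_smul' := by
    intro _ x i c φ
    rw [← ContinuousLinearMap.smul_comp]
    exact congrArg (· ∘L _) (((MultilinearMap.domDomCongrLinearEquiv' ℝ ℝ
      (fun i => Bidual (E i)) _ ρ.symm).symm
        (AronBerner.extend m (fun j => E (ρ j)))).map_update_smul x i c φ)

lemma aronBerner_apply (ρ : Equiv.Perm (Fin m)) (A : ContinuousMultilinearMap ℝ E F)
    (x : ∀ i, Bidual (E i)) (y : StrongDual ℝ F) :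
    aronBerner ρ A x y = AronBerner.extend m (fun j => E (ρ j)) (fun j => x (ρ j))
      (y.compContinuousMultilinearMap (AronBerner.reindex ρ A)) := rfl

end

/-! ### Disjoint families in vector lattices -/

namespace VectorLattice

section

variable {F : Type*} [AddCommGroup F] [Lattice F] [IsOrderedAddMonoid F]

/-! Finite rank. A finite dimensional vector sublattice lies in the span of finitely many pairwise
disjoint positive elements g (`exists_disjoint_le_span`). The modulus of a combination of disjoint
elements is taken coefficientwise, so each coordinate of A is a real-valued Riesz multimorphism.
Such a form is a nonnegative multiple of a product of Riesz homomorphisms (`exists_eq_prod`),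
because its partial functionals are proportional. Hence A is a finite sum of terms c ∏ hᵢ(xᵢ) g, and
every Aron–Berner extension is the sum of the terms c ∏ φᵢ(hᵢ) g, whatever the order of the
variables (`aronBerner_eq_sum_prod`). Evaluation at a Riesz homomorphism commutes with moduli on the
bidual, and the canonical embedding keeps the g disjoint, so the modulus passes through the formula.

Order continuous duals. The variables are extended one at a time, with y ∈ F* kept as a parameter
(`abs_extend_comp`). The one-variable statement is `abs_comp_eq`: the identity |t ∘ S| = |t| ∘ T for
t in E persists for φ in E**. The inequality ≤ is automatic; the other one follows if φ can be
approximated by elements t of E in every seminorm θ ↦ |θ|(f) with 0 ≤ f in E*.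

This density is `exists_abs_sub_incl_apply_lt`, and only here does order continuity enter: it makes
every φ ≥ 0 nearly dominated on [0, f] by some e in E (`exists_approx_dominated`). An element of [0,
e] in the bidual is then approximated by a binary expansion (`exists_approx_of_le_incl`), which is
valid in any Banach lattice. -/

lemma inf_add_le {a b c : F} (ha : 0 ≤ a) (hb : 0 ≤ b) (hc : 0 ≤ c) :
    a ⊓ (b + c) ≤ a ⊓ b + a ⊓ c := by
  rw [inf_add, add_inf, add_inf]
  refine le_inf (le_inf ?_ ?_) (le_inf ?_ inf_le_right)
  · exact inf_le_left.trans (le_add_of_nonneg_left ha)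
  · exact inf_le_left.trans (le_add_of_nonneg_right hc)
  · exact inf_le_left.trans (le_add_of_nonneg_left hb)

lemma inf_sum_eq_zero {ι : Type*} (s : Finset ι) {a : F} (ha : 0 ≤ a) {g : ι → F}
    (hg : ∀ i, 0 ≤ g i) (h : ∀ i ∈ s, a ⊓ g i = 0) : a ⊓ ∑ i ∈ s, g i = 0 := by
  classical
  induction s using Finset.induction_on with
  | empty => simpa using ha
  | insert i s hi ih =>
    rw [Finset.sum_insert hi]
    refine le_antisymm ?_ (le_inf ha (add_nonneg (hg i) (Finset.sum_nonneg fun j _ => hg j)))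
    refine (inf_add_le ha (hg i) (Finset.sum_nonneg fun j _ => hg j)).trans ?_
    rw [h i (by simp), ih fun j hj => h j (by simp [hj]), add_zero]

lemma abs_sub_of_inf_eq_zero {a b : F} (h : a ⊓ b = 0) : |a - b| = a + b := by
  rw [abs_sub_comm, ← sup_sub_inf_eq_abs_sub, h, sub_zero, ← inf_add_sup a b, h, zero_add]

/-- The Riesz decomposition property. -/
lemma exists_add_of_le_add {h a b : F} (hh : 0 ≤ h) (ha : 0 ≤ a) (hb : 0 ≤ b) (hab : h ≤ a + b) :
    ∃ x y : F, 0 ≤ x ∧ x ≤ a ∧ 0 ≤ y ∧ y ≤ b ∧ h = x + y := by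
  refine ⟨h ⊓ a, h - h ⊓ a, le_inf hh ha, inf_le_right, sub_nonneg.2 inf_le_left, ?_, by abel⟩
  rw [sub_le_comm]
  exact le_inf (sub_le_self _ hb) (sub_le_iff_le_add.2 hab)

/-- The distance from `y` to its truncation to the order interval `[0, w]`. -/
lemma abs_sub_clamp_le (y w : F) : |y - (y ⊔ 0) ⊓ w| ≤ (-y) ⊔ 0 + (y - w) ⊔ 0 := by
  refine abs_le'.2 ⟨?_, ?_⟩
  · have h1 : y ⊓ w ≤ (y ⊔ 0) ⊓ w := inf_le_inf_right _ le_sup_left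
    calc y - (y ⊔ 0) ⊓ w ≤ y - y ⊓ w := sub_le_sub_left h1 y
      _ = (y - w) ⊔ 0 := by rw [sub_inf, sub_self, sup_comm]
      _ ≤ _ := le_add_of_nonneg_left le_sup_right
  · calc -(y - (y ⊔ 0) ⊓ w) = (y ⊔ 0) ⊓ w - y := by abel
      _ ≤ y ⊔ 0 - y := sub_le_sub_right inf_le_left y
      _ = (-y) ⊔ 0 := by rw [sup_sub, sub_self, zero_sub, sup_comm]
      _ ≤ _ := le_add_of_nonneg_right le_sup_right

variable [Module ℝ F] [IsOrderedModule ℝ F]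

lemma smul_inf_smul_eq_zero {a b : F} (h : a ⊓ b = 0) {c d : ℝ} (hc : 0 ≤ c) (hd : 0 ≤ d) :
    (c • a) ⊓ (d • b) = 0 := by
  have ha : 0 ≤ a := h ▸ inf_le_left
  have hb : 0 ≤ b := h ▸ inf_le_right
  refine le_antisymm ?_ (le_inf (smul_nonneg hc ha) (smul_nonneg hd hb))
  -- After division by this constant both coefficients are at most 1; the added 1 keeps it positive
  -- when c = d = 0.
  have hM : 0 < max c d + 1 := by positivity
  have h1 : (max c d + 1)⁻¹ • ((c • a) ⊓ (d • b)) ≤ a ⊓ b := by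
    refine le_inf ?_ ?_
    · refine (smul_le_smul_of_nonneg_left inf_le_left (by positivity)).trans ?_
      rw [smul_smul]
      refine (smul_le_smul_of_nonneg_right (b := a) ?_ ha).trans_eq (one_smul ℝ a)
      rw [inv_mul_le_one₀ hM]
      linarith [le_max_left c d]
    · refine (smul_le_smul_of_nonneg_left inf_le_right (by positivity)).trans ?_
      rw [smul_smul]
      refine (smul_le_smul_of_nonneg_right (b := b) ?_ hb).trans_eq (one_smul ℝ b)
      rw [inv_mul_le_one₀ hM]
      linarith [le_max_right c d]
  rw [h] at h1
  have h2 := smul_le_smul_of_nonneg_left h1 hM.le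
  rwa [smul_smul, mul_inv_cancel₀ hM.ne', one_smul, smul_zero] at h2

/-- The parts of the sum with coefficients c⁺ and c⁻ are disjoint: for different indices because the
g are, for equal ones because c⁺ or c⁻ is zero. The modulus of a difference of disjoint elements is
their sum. -/
lemma abs_sum_smul_of_disjoint {ι : Type*} (s : Finset ι) (c : ι → ℝ) {g : ι → F}
    (hg : ∀ i, 0 ≤ g i) (hd : ∀ i j, i ≠ j → g i ⊓ g j = 0) :
    |∑ i ∈ s, c i • g i| = ∑ i ∈ s, |c i| • g i := by
  have h1 : ∑ i ∈ s, c i • g i = ∑ i ∈ s, (c i)⁺ • g i - ∑ i ∈ s, (c i)⁻ • g i := by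
    rw [← Finset.sum_sub_distrib]
    exact Finset.sum_congr rfl fun i _ => by rw [← sub_smul, posPart_sub_negPart]
  have h2 : (∑ i ∈ s, (c i)⁺ • g i) ⊓ (∑ i ∈ s, (c i)⁻ • g i) = 0 := by
    refine inf_sum_eq_zero s (Finset.sum_nonneg fun i _ => smul_nonneg (posPart_nonneg _) (hg i))
      (fun i => smul_nonneg (negPart_nonneg _) (hg i)) fun i _ => ?_
    rw [inf_comm]
    refine inf_sum_eq_zero s (smul_nonneg (negPart_nonneg _) (hg i))
      (fun i => smul_nonneg (posPart_nonneg _) (hg i)) fun j _ => ?_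
    by_cases hij : i = j
    · subst hij
      rcases le_total 0 (c i) with h | h
      · rw [negPart_eq_zero.2 h, zero_smul]
        exact inf_eq_left.2 (smul_nonneg (posPart_nonneg _) (hg i))
      · rw [posPart_eq_zero.2 h, zero_smul]
        exact inf_eq_right.2 (smul_nonneg (negPart_nonneg _) (hg i))
    · exact smul_inf_smul_eq_zero (hd i j hij) (negPart_nonneg _) (posPart_nonneg _)
  rw [h1, abs_sub_of_inf_eq_zero h2, ← Finset.sum_add_distrib]
  exact Finset.sum_congr rfl fun i _ => by rw [← add_smul, posPart_add_negPart]

/-- If a combination vanishes, so does its modulus, which is a sum of the positive terms |c i| • g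
i. -/
lemma linearIndependent_of_disjoint {ι : Type*} {g : ι → F} (hg : ∀ i, 0 < g i)
    (hd : ∀ i j, i ≠ j → g i ⊓ g j = 0) : LinearIndependent ℝ g := by
  rw [linearIndependent_iff']
  intro s c hc i hi
  have h1 := abs_sum_smul_of_disjoint s c (fun i => (hg i).le) hd
  rw [hc, abs_zero] at h1
  have h2 := (Finset.sum_eq_zero_iff_of_nonneg
    fun j _ => smul_nonneg (abs_nonneg (c j)) (hg j).le).1 h1.symm i hi
  simpa [(hg i).ne'] using h2

end

/-! ### Finite dimensional vector sublattices -/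

section

variable {F : Type v} [NormedAddCommGroup F] [NormedSpace ℝ F] [Lattice F] [IsBanachLattice F]

/-- The coefficient is the largest c with c • g ≤ v. The hypothesis says that g behaves like an
atom: it cannot meet both the positive and the negative part of w - c • g. A remainder meeting g
would therefore contain a further multiple of g. -/
lemma exists_smul_add_disjoint {g v : F} (hg : 0 < g) (hv : 0 ≤ v)
    (hsplit : ∀ c : ℝ, 0 < c → ∀ w : F, w ∈ Submodule.span ℝ {g, v} →
      (w - c • g)⁺ ⊓ g = 0 ∨ (w - c • g)⁻ ⊓ g = 0) :
    ∃ c : ℝ, 0 ≤ c ∧ c • g ≤ v ∧ (v - c • g) ⊓ g = 0 := by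
  have hgn : 0 < ‖g‖ := norm_pos_iff.2 hg.ne'
  set C : Set ℝ := {c | 0 ≤ c ∧ c • g ≤ v} with hC
  have hne : C.Nonempty := ⟨0, le_rfl, by simpa using hv⟩
  have hbdd : BddAbove C := by
    refine ⟨‖v‖ / ‖g‖, fun c hc => ?_⟩
    rw [le_div_iff₀ hgn]
    have : ‖c • g‖ ≤ ‖v‖ := by
      apply HasSolidNorm.solid
      rw [abs_of_nonneg (smul_nonneg hc.1 hg.le), abs_of_nonneg hv]
      exact hc.2
    rwa [norm_smul, Real.norm_of_nonneg hc.1] at this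
  have hcl : IsClosed C := by
    have h1 : IsClosed {c : ℝ | c • g ≤ v} :=
      isClosed_le (continuous_id.smul continuous_const) continuous_const
    exact isClosed_Ici.inter h1
  obtain ⟨h0, hle⟩ := hcl.csSup_mem hne hbdd
  refine ⟨sSup C, h0, hle, ?_⟩
  set r := v - sSup C • g with hr
  have hr0 : 0 ≤ r := sub_nonneg.2 hle
  have key : ∀ c : ℝ, 0 < c → r ⊓ g ≤ c • g := by
    intro c hc
    have hmem : r ∈ Submodule.span ℝ {g, v} :=
      Submodule.sub_mem _ (Submodule.subset_span (by simp))
        (Submodule.smul_mem _ _ (Submodule.subset_span (by simp)))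
    rcases hsplit c hc r hmem with h | h
    · have h1 : r ≤ c • g + (r - c • g)⁺ := by
        rw [← sub_le_iff_le_add']; exact le_posPart _
      calc r ⊓ g ≤ g ⊓ (c • g + (r - c • g)⁺) := le_inf inf_le_right (inf_le_left.trans h1)
        _ ≤ g ⊓ (c • g) + g ⊓ (r - c • g)⁺ :=
            inf_add_le hg.le (smul_nonneg hc.le hg.le) (posPart_nonneg _)
        _ = g ⊓ (c • g) := by rw [inf_comm g (r - c • g)⁺, h, add_zero]
        _ ≤ c • g := inf_le_right
    · exfalso
      -- This negative part is disjoint from g and below a multiple of g, hence zero. So c • g ≤ r,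
      -- against the maximality of `sSup C`.
      have h1 : (r - c • g)⁻ ≤ c • g := by
        refine sup_le ?_ (smul_nonneg hc.le hg.le)
        rw [neg_sub]
        exact sub_le_self _ hr0
      have h2 : (r - c • g)⁻ ⊓ (c • g) = 0 := by
        have := smul_inf_smul_eq_zero h (zero_le_one (α := ℝ)) hc.le
        rwa [one_smul] at this
      rw [inf_eq_left.2 h1] at h2
      have h3 : c • g ≤ r := sub_nonneg.1 (negPart_eq_zero.1 h2)
      have h4 : sSup C + c ∈ C := by
        refine ⟨by positivity, ?_⟩
        rw [add_smul, ← le_sub_iff_add_le']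
        exact h3
      have := le_csSup hbdd h4
      linarith
  have hlim : Filter.Tendsto (fun n : ℕ => (1 / ((n : ℝ) + 1)) • g) Filter.atTop
      (nhds ((0 : ℝ) • g)) :=
    tendsto_one_div_add_atTop_nhds_zero_nat.smul_const g
  rw [zero_smul] at hlim
  exact le_antisymm (ge_of_tendsto' hlim fun n => key _ (by positivity)) (le_inf hr0 hg.le)

/-- A finite dimensional vector sublattice is contained in the span of finitely many pairwise
disjoint positive elements. -/
theorem exists_disjoint_le_span (G : Submodule ℝ F) [FiniteDimensional ℝ G]
    (hG : ∀ x ∈ G, ∀ y ∈ G, x ⊔ y ∈ G ∧ x ⊓ y ∈ G) :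
    ∃ s : Finset F, (∀ g ∈ s, 0 < g) ∧ (∀ g ∈ s, ∀ h ∈ s, g ≠ h → g ⊓ h = 0) ∧
      G ≤ Submodule.span ℝ (s : Set F) := by
  classical
  -- Disjoint positive families in G are linearly independent, so one of maximal cardinality exists.
  -- Maximality forbids both adding a member and replacing a member by two disjoint pieces of it.
  let P : Finset F → Prop := fun s =>
    (∀ g ∈ s, g ∈ G ∧ 0 < g) ∧ (∀ g ∈ s, ∀ h ∈ s, g ≠ h → g ⊓ h = 0)
  have hcard : ∀ s, P s → s.card ≤ Module.finrank ℝ G := by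
    intro s hs
    have h1 : LinearIndependent ℝ (fun g : s => (g : F)) :=
      linearIndependent_of_disjoint (fun g => (hs.1 g g.2).2)
        fun g h hgh => hs.2 g g.2 h h.2 fun h' => hgh (Subtype.ext h')
    have h2 : LinearIndependent ℝ (fun g : s => (⟨g, (hs.1 g g.2).1⟩ : G)) :=
      LinearIndependent.of_comp G.subtype h1
    simpa using h2.fintype_card_le_finrank
  obtain ⟨s, hs, hmax⟩ : ∃ s, P s ∧ ∀ t, P t → t.card ≤ s.card := by
    obtain ⟨s, hs, hsn⟩ := Nat.findGreatest_spec
      (P := fun n => ∃ s, P s ∧ s.card = n) (n := Module.finrank ℝ G) (m := 0) (Nat.zero_le _)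
      ⟨∅, ⟨by simp, by simp⟩, rfl⟩
    refine ⟨s, hs, fun t ht => ?_⟩
    rw [hsn]
    exact Nat.le_findGreatest (hcard t ht) ⟨t, ht, rfl⟩
  have hpos : ∀ x ∈ G, x⁺ ∈ G := fun x hx => (hG x hx 0 G.zero_mem).1
  have hneg : ∀ x ∈ G, x⁻ ∈ G := fun x hx => (hG (-x) (G.neg_mem hx) 0 G.zero_mem).1
  -- an element disjoint to the whole family vanishes
  have hweak : ∀ v ∈ G, 0 ≤ v → (∀ g ∈ s, v ⊓ g = 0) → v = 0 := by
    intro v hv hv0 hd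
    by_contra hne
    have hvs : v ∉ s := fun h => hne (by simpa using hd v h)
    have h1 : P (insert v s) := by
      refine ⟨fun g hg => ?_, fun g hg h hh hgh => ?_⟩
      · rcases Finset.mem_insert.1 hg with rfl | hg
        · exact ⟨hv, lt_of_le_of_ne hv0 (Ne.symm hne)⟩
        · exact hs.1 g hg
      · rcases Finset.mem_insert.1 hg with h1 | hg <;> rcases Finset.mem_insert.1 hh with h2 | hh
        · exact absurd (h1.trans h2.symm) hgh
        · rw [h1]; exact hd h hh
        · rw [h2, inf_comm]; exact hd g hg
        · exact hs.2 g hg h hh hgh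
    have := hmax _ h1
    rw [Finset.card_insert_of_notMem hvs] at this
    omega
  -- members of the family cannot be split
  have hatom : ∀ g ∈ s, ∀ x ∈ G, ∀ y ∈ G, 0 ≤ x → 0 ≤ y → x ⊓ y = 0 →
      x ⊓ g = 0 ∨ y ⊓ g = 0 := by
    intro g hg x hx y hy hx0 hy0 hxy
    by_contra! hcon
    have hgG := (hs.1 g hg).1
    have hg0 := (hs.1 g hg).2.le
    have hsub : ∀ z, 0 ≤ z → ∀ h ∈ s.erase g, (z ⊓ g) ⊓ h = 0 := fun z hz h hh => by
      refine le_antisymm ?_ (le_inf (le_inf hz hg0) (hs.1 h (Finset.mem_of_mem_erase hh)).2.le)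
      rw [← hs.2 g hg h (Finset.mem_of_mem_erase hh) (Finset.ne_of_mem_erase hh).symm]
      exact inf_le_inf_right _ inf_le_right
    have hne0 : ∀ z, 0 ≤ z → z ⊓ g ≠ 0 → 0 < z ⊓ g := fun z hz h =>
      lt_of_le_of_ne (le_inf hz hg0) (Ne.symm h)
    have hnot : ∀ z, 0 ≤ z → z ⊓ g ≠ 0 → z ⊓ g ∉ s.erase g := fun z hz h h' =>
      h (by simpa using hsub z hz _ h')
    have hxy' : (x ⊓ g) ⊓ (y ⊓ g) = 0 :=
      le_antisymm ((inf_le_inf inf_le_left inf_le_left).trans hxy.le)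
        (le_inf (le_inf hx0 hg0) (le_inf hy0 hg0))
    have hnot2 : x ⊓ g ∉ insert (y ⊓ g) (s.erase g) := by
      rw [Finset.mem_insert, not_or]
      refine ⟨fun h => hcon.1 ?_, hnot x hx0 hcon.1⟩
      rw [← h] at hxy'
      simpa using hxy'
    have h1 : P (insert (x ⊓ g) (insert (y ⊓ g) (s.erase g))) := by
      refine ⟨fun a ha => ?_, fun a ha b hb hab => ?_⟩
      · rcases Finset.mem_insert.1 ha with rfl | ha
        · exact ⟨(hG x hx g hgG).2, hne0 x hx0 hcon.1⟩
        rcases Finset.mem_insert.1 ha with rfl | ha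
        · exact ⟨(hG y hy g hgG).2, hne0 y hy0 hcon.2⟩
        · exact hs.1 a (Finset.mem_of_mem_erase ha)
      · simp only [Finset.mem_insert] at ha hb
        rcases ha with h1 | h1 | h1 <;> rcases hb with h2 | h2 | h2
        · exact absurd (h1.trans h2.symm) hab
        · rw [h1, h2, hxy']
        · rw [h1]; exact hsub x hx0 b h2
        · rw [h1, h2, inf_comm, hxy']
        · exact absurd (h1.trans h2.symm) hab
        · rw [h1]; exact hsub y hy0 b h2
        · rw [h2, inf_comm]; exact hsub x hx0 a h1
        · rw [h2, inf_comm]; exact hsub y hy0 a h1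
        · exact hs.2 a (Finset.mem_of_mem_erase h1) b (Finset.mem_of_mem_erase h2) hab
    have h2 := hmax _ h1
    rw [Finset.card_insert_of_notMem hnot2, Finset.card_insert_of_notMem (hnot y hy0 hcon.2),
      Finset.card_erase_of_mem hg] at h2
    have := Finset.card_pos.2 ⟨g, hg⟩
    omega
  refine ⟨s, fun g hg => (hs.1 g hg).2, hs.2, ?_⟩
  -- Multiples of the members are peeled off one by one. The remainder only decreases, so it stays
  -- disjoint from the members already treated.
  have hstep : ∀ t : Finset F, t ⊆ s → ∀ v ∈ G, 0 ≤ v → ∃ r ∈ G, 0 ≤ r ∧ r ≤ v ∧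
      v - r ∈ Submodule.span ℝ (s : Set F) ∧ ∀ g ∈ t, r ⊓ g = 0 := by
    intro t
    induction t using Finset.induction_on with
    | empty => exact fun _ v hv hv0 => ⟨v, hv, hv0, le_rfl, by simp, by simp⟩
    | insert g t hgt ih =>
      intro hts v hv hv0
      obtain ⟨r, hrG, hr0, hrv, hspan, hd⟩ := ih ((Finset.subset_insert g t).trans hts) v hv hv0
      have hg := hts (Finset.mem_insert_self g t)
      obtain ⟨c, hc, hcr, hdis⟩ := exists_smul_add_disjoint (hs.1 g hg).2 hr0 (by
        intro c _ w hw
        have hwG : w ∈ G := by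
          refine Submodule.span_le.2 ?_ hw
          rintro z (rfl | rfl)
          exacts [(hs.1 z hg).1, hrG]
        have hwc : w - c • g ∈ G := G.sub_mem hwG (G.smul_mem c (hs.1 g hg).1)
        exact hatom g hg _ (hpos _ hwc) _ (hneg _ hwc) (posPart_nonneg _) (negPart_nonneg _)
          (posPart_inf_negPart_eq_zero _))
      have hle : r - c • g ≤ r := sub_le_self _ (smul_nonneg hc (hs.1 g hg).2.le)
      refine ⟨r - c • g, G.sub_mem hrG (G.smul_mem c (hs.1 g hg).1), sub_nonneg.2 hcr,
        hle.trans hrv, ?_, fun h hh => ?_⟩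
      · rw [← sub_add]
        exact Submodule.add_mem _ hspan (Submodule.smul_mem _ _ (Submodule.subset_span hg))
      · rcases Finset.mem_insert.1 hh with rfl | hh
        · exact hdis
        · refine le_antisymm ((inf_le_inf_right _ hle).trans (hd h hh).le)
            (le_inf (sub_nonneg.2 hcr) (hs.1 h (hts (Finset.mem_insert_of_mem hh))).2.le)
  have hnn : ∀ v ∈ G, 0 ≤ v → v ∈ Submodule.span ℝ (s : Set F) := by
    intro v hv hv0
    obtain ⟨r, hrG, hr0, -, hspan, hd⟩ := hstep s subset_rfl v hv hv0
    rwa [hweak r hrG hr0 hd, sub_zero] at hspan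
  intro v hv
  rw [← posPart_sub_negPart v]
  exact Submodule.sub_mem _ (hnn _ (hpos v hv) (posPart_nonneg v))
    (hnn _ (hneg v hv) (negPart_nonneg v))

end

end VectorLattice

/-! ### The generated vector sublattice -/

lemma rieszSpan_sup_inf_mem {F : Type v} [AddCommGroup F] [Module ℝ F] [Lattice F] (S : Set F) :
    ∀ x ∈ rieszSpan S, ∀ y ∈ rieszSpan S, x ⊔ y ∈ rieszSpan S ∧ x ⊓ y ∈ rieszSpan S := by
  intro x hx y hy
  simp only [rieszSpan, Submodule.mem_sInf] at hx hy ⊢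
  exact ⟨fun G hG => (hG.2 x (hx G hG) y (hy G hG)).1, fun G hG => (hG.2 x (hx G hG) y (hy G hG)).2⟩

lemma subset_rieszSpan {F : Type v} [AddCommGroup F] [Module ℝ F] [Lattice F] (S : Set F) :
    S ⊆ rieszSpan S := by
  intro x hx
  simp only [rieszSpan, SetLike.mem_coe, Submodule.mem_sInf]
  exact fun G hG => hG.1 hx

/-! ### Formulas in the dual and the bidual -/

namespace DualLattice

variable {E : Type u} [NormedAddCommGroup E] [NormedSpace ℝ E] [Lattice E] [IsBanachLattice E]

instance instIsOrderedModule : IsOrderedModule ℝ (StrongDual ℝ E) :=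
  instIsBanachLattice.toIsOrderedModule

lemma apply_mono {φ : StrongDual ℝ E} (hφ : 0 ≤ φ) {x y : E} (h : x ≤ y) : φ x ≤ φ y := by
  have : 0 ≤ φ (y - x) := le_iff.1 hφ (y - x) (sub_nonneg.2 h)
  rw [map_sub] at this
  exact sub_nonneg.1 this

lemma apply_nonneg {φ : StrongDual ℝ E} (hφ : 0 ≤ φ) {x : E} (h : 0 ≤ x) : 0 ≤ φ x :=
  le_iff.1 hφ x h

lemma le_abs_apply (φ : StrongDual ℝ E) {x z : E} (h : |z| ≤ x) : φ z ≤ |φ| x :=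
  (le_abs_self _).trans ((abs_apply_le φ z).trans (apply_mono (abs_nonneg φ) h))

/-- By the Riesz–Kantorovich formula for φ ⊔ -φ, the value |φ| x is the supremum of φ (x - 2y) over
y in [0, x], and |x - 2y| ≤ x. -/
lemma abs_apply_le_of_forall (φ : StrongDual ℝ E) {x : E} (hx : 0 ≤ x) {c : ℝ}
    (h : ∀ z, |z| ≤ x → φ z ≤ c) : |φ| x ≤ c := by
  rw [abs, sup_apply φ (-φ) hx, ← le_sub_iff_add_le']
  apply csSup_le (vals_nonempty (-φ - φ) hx)
  rintro _ ⟨y, hy, rfl⟩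
  have h1 : φ (x - y - y) ≤ c := by
    refine h _ (abs_le'.2 ⟨?_, ?_⟩)
    · exact (sub_le_self _ hy.1).trans (sub_le_self _ hy.1)
    · rw [neg_le_iff_add_nonneg]
      have : x + (x - y - y) = (x - y) + (x - y) := by abel
      rw [this]
      exact add_nonneg (sub_nonneg.2 hy.2) (sub_nonneg.2 hy.2)
  simp only [map_sub] at h1
  simp only [sub_apply, neg_apply]
  linarith

lemma sup_zero_apply_le_of_forall (φ : StrongDual ℝ E) {x : E} (hx : 0 ≤ x) {c : ℝ}
    (h : ∀ z, 0 ≤ z → z ≤ x → φ z ≤ c) : (φ ⊔ 0) x ≤ c := by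
  rw [sup_comm, sup_apply 0 φ hx, sub_zero, zero_apply, zero_add]
  exact pos_le φ hx h

/-- (φ ⊓ ψ) x is the infimum of φ (x - u) + ψ u over u in [0, x]. If it is zero, a near-minimizer
makes both nonnegative terms small. -/
lemma exists_of_inf_eq_zero {φ ψ : StrongDual ℝ E} (h : φ ⊓ ψ = 0) {x : E} (hx : 0 ≤ x) {ε : ℝ}
    (hε : 0 < ε) : ∃ u, 0 ≤ u ∧ u ≤ x ∧ ψ u < ε ∧ φ (x - u) < ε := by
  have hφ : 0 ≤ φ := h ▸ inf_le_left
  have hψ : 0 ≤ ψ := h ▸ inf_le_right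
  have h1 : φ x - pos (φ - ψ) x = 0 := by
    rw [← posDual_apply _ hx]
    exact congrArg (fun χ : StrongDual ℝ E => χ x) h
  obtain ⟨_, ⟨u, hu, rfl⟩, hlt⟩ := exists_lt_of_lt_csSup (vals_nonempty (φ - ψ) hx)
    (show pos (φ - ψ) x - ε < sSup (vals (φ - ψ) x) from sub_lt_self _ hε)
  simp only [sub_apply] at hlt
  have h2 := apply_nonneg hψ hu.1
  have h3 := apply_nonneg hφ (sub_nonneg.2 hu.2)
  rw [map_sub] at h3
  refine ⟨u, hu.1, hu.2, ?_, ?_⟩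
  · linarith
  · rw [map_sub]; linarith

/-- A positive linear functional dominated by a continuous one is continuous. -/
lemma exists_dual_of_le (s : E →ₗ[ℝ] ℝ) (f : StrongDual ℝ E) (hs : ∀ x, 0 ≤ x → 0 ≤ s x)
    (hsf : ∀ x, 0 ≤ x → s x ≤ f x) : ∃ g : StrongDual ℝ E, 0 ≤ g ∧ g ≤ f ∧ ∀ x, g x = s x := by
  refine ⟨s.mkContinuous ‖f‖ fun x => ?_, hs, hsf, fun x => rfl⟩
  have hmono : ∀ a b : E, a ≤ b → s a ≤ s b := fun a b hab => by
    have := hs (b - a) (sub_nonneg.2 hab)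
    rw [map_sub] at this
    exact sub_nonneg.1 this
  have h1 : ‖s x‖ ≤ s |x| := by
    rw [Real.norm_eq_abs, abs_le']
    exact ⟨hmono _ _ (le_abs_self x), by rw [← map_neg]; exact hmono _ _ (neg_le_abs x)⟩
  refine h1.trans ((hsf _ (abs_nonneg x)).trans ((le_abs_self _).trans ?_))
  rw [← norm_abs_eq_norm x]
  exact f.le_opNorm _

/-- The canonical embedding into the bidual. -/
noncomputable abbrev incl (E : Type u) [NormedAddCommGroup E] [NormedSpace ℝ E] :
    E →L[ℝ] Bidual E :=
  NormedSpace.inclusionInDoubleDual ℝ E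

lemma incl_mono {x y : E} (h : x ≤ y) : incl E x ≤ incl E y :=
  fun _ hf => apply_mono hf h

lemma abs_incl_le (x : E) : |incl E x| ≤ incl E |x| :=
  abs_le'.2 ⟨incl_mono (le_abs_self x), by rw [← map_neg]; exact incl_mono (neg_le_abs x)⟩

/-- Some functional in `[0, y]` takes the value `y x⁺` at `x`. -/
lemma exists_le_apply_eq_posPart (y : StrongDual ℝ E) (hy : 0 ≤ y) (x : E) :
    ∃ z : StrongDual ℝ E, 0 ≤ z ∧ z ≤ y ∧ z x = y x⁺ := by
  by_cases hx : x = 0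
  · exact ⟨0, le_rfl, hy, by simp [hx]⟩
  have hsub : ∀ a b : E, (a + b)⁺ ≤ a⁺ + b⁺ := fun a b =>
    sup_le (add_le_add (le_posPart a) (le_posPart b))
      (add_nonneg (posPart_nonneg a) (posPart_nonneg b))
  have hhom : ∀ c : ℝ, 0 ≤ c → ∀ a : E, (c • a)⁺ ≤ c • a⁺ := fun c hc a =>
    sup_le (smul_le_smul_of_nonneg_left (le_posPart a) hc) (smul_nonneg hc (posPart_nonneg a))
  have hhom' : ∀ c : ℝ, 0 < c → ∀ a : E, (c • a)⁺ = c • a⁺ := fun c hc a => by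
    refine le_antisymm (hhom c hc.le a) ?_
    have := smul_le_smul_of_nonneg_left (hhom c⁻¹ (inv_nonneg.2 hc.le) (c • a)) hc.le
    rwa [smul_smul, smul_smul, inv_mul_cancel₀ hc.ne', mul_inv_cancel₀ hc.ne', one_smul,
      one_smul] at this
  -- Hahn–Banach for the sublinear map a ↦ y a⁺, starting from x ↦ y x⁺ on the line through x.
  -- Domination at -a with a ≥ 0 makes the extension positive, and at a it bounds it by y.
  obtain ⟨g, hg, hgN⟩ := exists_extension_of_le_sublinear
    (LinearPMap.mkSpanSingleton x (y x⁺) hx) (fun a => y a⁺)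
    (fun c hc a => by rw [hhom' c hc, map_smul, smul_eq_mul])
    (fun a b => by rw [← map_add]; exact apply_mono hy (hsub a b))
    (by
      rintro ⟨a, ha⟩
      obtain ⟨c, rfl⟩ := Submodule.mem_span_singleton.1 ha
      refine (LinearPMap.mkSpanSingleton'_apply x (y x⁺) _ c ha).trans_le ?_
      rw [smul_eq_mul]
      rcases le_or_gt c 0 with hc | hc
      · exact (mul_nonpos_of_nonpos_of_nonneg hc (apply_nonneg hy (posPart_nonneg x))).trans
          (apply_nonneg hy (posPart_nonneg _))
      · simp only
        rw [hhom' c hc, map_smul, smul_eq_mul, RingHom.id_apply])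
  have hg0 : ∀ a, 0 ≤ a → 0 ≤ g a := fun a ha => by
    have := hgN (-a)
    rw [posPart_eq_zero.2 (neg_nonpos.2 ha), map_zero, map_neg] at this
    linarith
  have hgy : ∀ a, 0 ≤ a → g a ≤ y a := fun a ha => by
    have := hgN a
    rwa [posPart_eq_self.2 ha] at this
  obtain ⟨z, hz0, hzy, hz⟩ := exists_dual_of_le g y hg0 hgy
  refine ⟨z, hz0, hzy, ?_⟩
  have := hg ⟨x, Submodule.mem_span_singleton_self x⟩
  rw [hz, this]
  exact LinearPMap.mkSpanSingleton_apply ℝ ℝ hx (y x⁺)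

/-- The canonical embedding into the bidual is a Riesz homomorphism. -/
lemma abs_incl (x : E) : |incl E x| = incl E |x| := by
  refine le_antisymm (abs_incl_le x) fun y hy => ?_
  obtain ⟨z, hz0, hzy, hz⟩ := exists_le_apply_eq_posPart y hy x
  -- Since 0 ≤ z ≤ y, the functional 2z - y has modulus at most y; its value at x is 2 y x⁺ - y x =
  -- y |x|.
  have h1 : (incl E x) (z + z - y) ≤ |incl E x| y := by
    refine le_abs_apply _ (abs_le'.2 ⟨?_, ?_⟩)
    · rw [sub_le_iff_le_add]
      exact add_le_add hzy hzy
    · rw [neg_sub, sub_le_self_iff]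
      exact add_nonneg hz0 hz0
  refine le_trans (le_of_eq ?_) h1
  have h2 : y |x| = y x⁺ + y x⁻ := by rw [← map_add, posPart_add_negPart]
  have h3 : y x = y x⁺ - y x⁻ := by rw [← map_sub, posPart_sub_negPart]
  simp only [NormedSpace.dual_def, sub_apply, add_apply]
  rw [hz, h2, h3]
  ring

end DualLattice

/-! ### Approximation of bidual elements by elements of the space -/

namespace DualLattice

variable {E : Type u} [NormedAddCommGroup E] [NormedSpace ℝ E] [Lattice E] [IsBanachLattice E]

/-- One step of the approximation: `φ` agrees with `(incl e₁ + y) / 2` for some `e₁ ∈ [0, e]` and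
some `y` which lies in `[0, incl e]` up to a small error. -/
lemma exists_halving (f : StrongDual ℝ E) (hf : 0 ≤ f) {e : E} (he : 0 ≤ e) {φ : Bidual E}
    (hφ : 0 ≤ φ) (hφe : φ ≤ incl E e) {ε : ℝ} (hε : 0 < ε) :
    ∃ e₁ : E, ∀ h, 0 ≤ h → h ≤ f → h e₁ - 2 * φ h ≤ 5 * ε ∧ 2 * φ h - h e₁ - h e ≤ 5 * ε := by
  set θ : Bidual E := φ - (1 / 2 : ℝ) • incl E e with hθ
  have hθa : ∀ h : StrongDual ℝ E, θ h = φ h - 1 / 2 * h e := fun h => rfl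
  -- f is cut into b, where θ⁺ is small (φ is below e/2), and a = f - b, where θ⁻ is small (φ is
  -- above e/2).
  obtain ⟨b, hb0, hbf, hb, ha⟩ := exists_of_inf_eq_zero (φ := θ⁻) (ψ := θ⁺)
    (by rw [inf_comm]; exact posPart_inf_negPart_eq_zero θ) hf hε
  set a := f - b with hadef
  have ha0 : 0 ≤ a := sub_nonneg.2 hbf
  set c := a ⊓ b with hc
  have hc0 : 0 ≤ c := le_inf ha0 hb0
  -- On the overlap c both θ⁺ and θ⁻ are small. Away from it the two pieces are disjoint, so some e₁
  -- in [0, e] is almost e for a - c and almost 0 for b - c: it plays the first binary digit of φ.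
  have hdis : (a - c) ⊓ (b - c) = 0 := by rw [← inf_sub, ← hc, sub_self]
  obtain ⟨e₁, he₁, he₁e, h2, h1⟩ := exists_of_inf_eq_zero hdis he hε
  have hpn : ∀ h, θ h = θ⁺ h - θ⁻ h := fun h => by
    conv_lhs => rw [← posPart_sub_negPart θ]
    rfl
  have hp0 : 0 ≤ θ⁺ := posPart_nonneg θ
  have hn0 : 0 ≤ θ⁻ := negPart_nonneg θ
  have hp : ∀ h, 0 ≤ h → θ⁺ h ≤ 1 / 2 * h e := by
    have : θ⁺ ≤ (1 / 2 : ℝ) • incl E e := by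
      refine sup_le (fun h hh => ?_) (smul_nonneg (by norm_num) ?_)
      · have h3 : φ h ≤ h e := hφe h hh
        change θ h ≤ 1 / 2 * h e
        rw [hθa]; linarith
      · exact (map_zero (incl E)).symm.trans_le (incl_mono he)
    exact fun h hh => this h hh
  have hn : ∀ h, 0 ≤ h → θ⁻ h ≤ 1 / 2 * h e := by
    have : θ⁻ ≤ (1 / 2 : ℝ) • incl E e := by
      refine sup_le (fun h hh => ?_) (smul_nonneg (by norm_num) ?_)
      · have h3 : 0 ≤ φ h := hφ h hh
        change -θ h ≤ 1 / 2 * h e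
        rw [hθa]; linarith
      · exact (map_zero (incl E)).symm.trans_le (incl_mono he)
    exact fun h hh => this h hh
  have hca : c ≤ a := inf_le_left
  have hcb : c ≤ b := inf_le_right
  refine ⟨e₁, fun h hh0 hhf => ⟨?_, ?_⟩⟩
  -- On x ≤ a + c the error θ⁻ is below 2ε, which costs 4ε after doubling; on y ≤ b - c the element
  -- e₁ costs another ε.
  · obtain ⟨x, y, hx0, hx, hy0, hy, rfl⟩ := VectorLattice.exists_add_of_le_add hh0
      (add_nonneg ha0 hc0) (sub_nonneg.2 hcb) (hhf.trans_eq (by rw [hadef]; abel))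
    have k1 : θ⁻ x ≤ θ⁻ a + θ⁻ c := by rw [← map_add]; exact apply_mono hn0 hx
    have k2 := apply_mono hn0 hca
    have k3 := hn y hy0
    have k4 : y e₁ ≤ (b - c) e₁ := hy e₁ he₁
    have k5 := apply_nonneg hp0 (add_nonneg hx0 hy0)
    have k6 := hpn (x + y)
    have k7 := hθa (x + y)
    have k8 := apply_mono hx0 he₁e
    simp only [map_add, add_apply] at *
    linarith
  · obtain ⟨x, y, hx0, hx, hy0, hy, rfl⟩ := VectorLattice.exists_add_of_le_add hh0
      (sub_nonneg.2 hca) (add_nonneg hb0 hc0) (hhf.trans_eq (by rw [hadef]; abel))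
    have k1 : θ⁺ y ≤ θ⁺ b + θ⁺ c := by rw [← map_add]; exact apply_mono hp0 hy
    have k2 := apply_mono hp0 hcb
    have k3 := hp x hx0
    have k4 : x (e - e₁) ≤ (a - c) (e - e₁) := hx _ (sub_nonneg.2 he₁e)
    have k5 := apply_nonneg hn0 (add_nonneg hx0 hy0)
    have k6 := hpn (x + y)
    have k7 := hθa (x + y)
    have k8 := apply_nonneg hy0 he₁
    rw [map_sub x e e₁] at k4
    simp only [map_add, add_apply] at *
    linarith

/-- Binary expansion: φ is nearly (e₁ + y)/2 with y nearly in [0, e], so y is truncated to that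
interval and expanded in turn. Each digit halves the initial error f e. -/
lemma exists_approx_of_le_incl (f : StrongDual ℝ E) (hf : 0 ≤ f) (n : ℕ) :
    ∀ (e : E) (φ : Bidual E), 0 ≤ e → 0 ≤ φ → φ ≤ incl E e → ∀ δ : ℝ, 0 < δ →
      ∃ t : E, |φ - incl E t| f ≤ (1 / 2) ^ n * f e + δ := by
  induction n with
  | zero =>
    intro e φ _ hφ hφe δ hδ
    refine ⟨0, ?_⟩
    have h : φ f ≤ f e := hφe f hf
    rw [map_zero, sub_zero φ, abs_of_nonneg hφ]
    linarith
  | succ n ih =>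
    intro e φ he hφ hφe δ hδ
    have he' : 0 ≤ incl E e := (map_zero (incl E)).symm.trans_le (incl_mono he)
    -- With ε = δ/10 each side of the truncation costs 5ε = δ/2. The total δ, averaged with the
    -- error δ of the next stage, gives δ again.
    obtain ⟨e₁, h₁⟩ := exists_halving f hf he hφ hφe (ε := δ / 10) (by positivity)
    set y : Bidual E := (2 : ℝ) • φ - incl E e₁ with hy
    obtain ⟨t, ht⟩ := ih e ((y ⊔ 0) ⊓ incl E e) he (le_inf le_sup_right he') inf_le_right δ hδ
    have h2 : |y - (y ⊔ 0) ⊓ incl E e| f ≤ δ / 2 + δ / 2 := by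
      refine (VectorLattice.abs_sub_clamp_le y (incl E e) f hf).trans ?_
      rw [add_apply]
      refine add_le_add (sup_zero_apply_le_of_forall _ hf fun h hh0 hhf => ?_)
        (sup_zero_apply_le_of_forall _ hf fun h hh0 hhf => ?_)
      · change -(2 * φ h - h e₁) ≤ _
        linarith [(h₁ h hh0 hhf).1]
      · change 2 * φ h - h e₁ - h e ≤ _
        linarith [(h₁ h hh0 hhf).2]
    refine ⟨(1 / 2 : ℝ) • (t + e₁), ?_⟩
    have h3 : φ - incl E ((1 / 2 : ℝ) • (t + e₁)) =
        (1 / 2 : ℝ) • ((y - (y ⊔ 0) ⊓ incl E e) + ((y ⊔ 0) ⊓ incl E e - incl E t)) := by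
      rw [hy, map_smul, map_add]
      module
    have h4 : |φ - incl E ((1 / 2 : ℝ) • (t + e₁))| ≤ (1 / 2 : ℝ) •
        (|y - (y ⊔ 0) ⊓ incl E e| + |(y ⊔ 0) ⊓ incl E e - incl E t|) := by
      rw [h3]
      refine abs_le'.2 ⟨?_, ?_⟩
      · exact smul_le_smul_of_nonneg_left
          (add_le_add (le_abs_self _) (le_abs_self _)) (by norm_num)
      · rw [← smul_neg (1 / 2 : ℝ) (_ : Bidual E), neg_add (_ : Bidual E) _]
        exact smul_le_smul_of_nonneg_left
          (add_le_add (neg_le_abs _) (neg_le_abs _)) (by norm_num)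
    refine (h4 f hf).trans ?_
    change 1 / 2 * (|y - (y ⊔ 0) ⊓ incl E e| f + |(y ⊔ 0) ⊓ incl E e - incl E t| f) ≤ _
    rw [pow_succ]
    linarith

/-! ### Order continuity of the dual norm -/

/-- Directed sets in an order interval `[0, f]` of the dual have a supremum, computed pointwise. -/
lemma exists_isLUB_of_directed {D : Set (StrongDual ℝ E)} (hne : D.Nonempty)
    (hdir : DirectedOn (· ≤ ·) D) (f : StrongDual ℝ E) (hD : ∀ d ∈ D, 0 ≤ d ∧ d ≤ f) :
    ∃ s, IsLUB D s := by
  have : Nonempty D := hne.to_subtype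
  have : IsDirectedOrder D := ⟨directedOn_iff_directed.1 hdir⟩
  have hlim : ∀ x : E, 0 ≤ x → Filter.Tendsto (fun d : D => (d : StrongDual ℝ E) x) Filter.atTop
      (nhds (⨆ d : D, (d : StrongDual ℝ E) x)) := fun x hx => by
    refine tendsto_atTop_ciSup (fun a b hab => hab x hx) ⟨f x, ?_⟩
    rintro _ ⟨d, rfl⟩
    exact (hD d d.2).2 x hx
  have hlim' : ∀ x : E, ∃ l, Filter.Tendsto (fun d : D => (d : StrongDual ℝ E) x) Filter.atTop
      (nhds l) := fun x => by
    refine ⟨_, ((hlim _ (posPart_nonneg x)).sub (hlim _ (negPart_nonneg x))).congr fun d => ?_⟩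
    rw [← map_sub, posPart_sub_negPart]
  choose l hl using hlim'
  let L : E →ₗ[ℝ] ℝ := linearMapOfTendsto l
    (fun d : D => ((d : StrongDual ℝ E) : E →ₗ[ℝ] ℝ)) (tendsto_pi_nhds.2 hl)
  obtain ⟨s, -, -, hs⟩ := exists_dual_of_le L f
    (fun x hx => ge_of_tendsto' (hl x) fun d => (hD d d.2).1 x hx)
    (fun x hx => le_of_tendsto' (hl x) fun d => (hD d d.2).2 x hx)
  have hsl : ∀ x, s x = l x := hs
  refine ⟨s, fun d hd x hx => ?_, fun c hc x hx => ?_⟩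
  · rw [hsl]
    refine ge_of_tendsto (hl x) ?_
    filter_upwards [Filter.eventually_ge_atTop (⟨d, hd⟩ : D)] with d' hd'
    exact hd' x hx
  · rw [hsl]
    exact le_of_tendsto' (hl x) fun d => hc d.2 x hx

/-- Order continuity of the norm along downward directed sets. -/
lemma exists_isGLB_of_directed (hE : HasOrderContinuousNorm (StrongDual ℝ E))
    {D : Set (StrongDual ℝ E)} (hne : D.Nonempty) (hdir : DirectedOn (fun x y => y ≤ x) D)
    (f : StrongDual ℝ E) (hD : ∀ d ∈ D, 0 ≤ d ∧ d ≤ f) :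
    ∃ s, IsGLB D s ∧ ∀ (φ : Bidual E) (ε : ℝ), 0 < ε → ∃ d ∈ D, φ d < φ s + ε := by
  obtain ⟨r, hr⟩ := exists_isLUB_of_directed (D := (fun d => f - d) '' D) (hne.image _)
    (by
      rintro _ ⟨a, ha, rfl⟩ _ ⟨b, hb, rfl⟩
      obtain ⟨c, hc, hca, hcb⟩ := hdir a ha b hb
      exact ⟨_, ⟨c, hc, rfl⟩, sub_le_sub_left hca f, sub_le_sub_left hcb f⟩) f
    (by
      rintro _ ⟨a, ha, rfl⟩
      exact ⟨sub_nonneg.2 (hD a ha).2, sub_le_self _ (hD a ha).1⟩)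
  have hglb : IsGLB D (f - r) := by
    refine ⟨fun d hd => sub_le_comm.1 (hr.1 ⟨d, hd, rfl⟩), fun c hc => ?_⟩
    rw [le_sub_comm]
    refine hr.2 ?_
    rintro _ ⟨d, hd, rfl⟩
    exact sub_le_sub_left (hc hd) f
  refine ⟨f - r, hglb, fun φ ε hε => ?_⟩
  set s := f - r
  obtain ⟨_, ⟨d, hd, rfl⟩, hlt⟩ := hE ((fun d => d - s) '' D) (hne.image _)
    (by
      rintro _ ⟨a, ha, rfl⟩ _ ⟨b, hb, rfl⟩
      obtain ⟨c, hc, hca, hcb⟩ := hdir a ha b hb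
      exact ⟨_, ⟨c, hc, rfl⟩, sub_le_sub_right hca s, sub_le_sub_right hcb s⟩)
    (by
      refine ⟨?_, fun c hc => ?_⟩
      · rintro _ ⟨d, hd, rfl⟩
        exact sub_nonneg.2 (hglb.1 hd)
      · have : c + s ≤ s := hglb.2 fun d hd => le_sub_iff_add_le.1 (hc ⟨d, hd, rfl⟩)
        simpa using this) (ε / (‖φ‖ + 1)) (by positivity)
  refine ⟨d, hd, ?_⟩
  have h1 := hlt _ ⟨d, hd, rfl⟩ le_rfl
  have h2 : φ (d - s) ≤ ‖φ‖ * ‖d - s‖ := (le_abs_self _).trans (φ.le_opNorm _)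
  rw [lt_div_iff₀ (by positivity)] at h1
  rw [map_sub] at h2
  nlinarith [norm_nonneg φ, norm_nonneg (d - s)]

lemma exists_isLUB_of_directed' (hE : HasOrderContinuousNorm (StrongDual ℝ E))
    {D : Set (StrongDual ℝ E)} (hne : D.Nonempty) (hdir : DirectedOn (· ≤ ·) D)
    (f : StrongDual ℝ E) (hD : ∀ d ∈ D, 0 ≤ d ∧ d ≤ f) :
    ∃ s, IsLUB D s ∧ ∀ (φ : Bidual E) (ε : ℝ), 0 < ε → ∃ d ∈ D, φ s < φ d + ε := by
  obtain ⟨r, hr, hφ⟩ := exists_isGLB_of_directed hE (D := (fun d => f - d) '' D) (hne.image _)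
    (by
      rintro _ ⟨a, ha, rfl⟩ _ ⟨b, hb, rfl⟩
      obtain ⟨c, hc, hca, hcb⟩ := hdir a ha b hb
      exact ⟨_, ⟨c, hc, rfl⟩, sub_le_sub_left hca f, sub_le_sub_left hcb f⟩) f
    (by
      rintro _ ⟨a, ha, rfl⟩
      exact ⟨sub_nonneg.2 (hD a ha).2, sub_le_self _ (hD a ha).1⟩)
  refine ⟨f - r, ⟨fun d hd => le_sub_comm.1 (hr.1 ⟨d, hd, rfl⟩), fun c hc => ?_⟩, fun φ ε hε => ?_⟩
  · rw [sub_le_comm]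
    refine hr.2 ?_
    rintro _ ⟨d, hd, rfl⟩
    exact sub_le_sub_left (hc hd) f
  · obtain ⟨_, ⟨d, hd, rfl⟩, h⟩ := hφ φ ε hε
    refine ⟨d, hd, ?_⟩
    simp only [map_sub] at h ⊢
    linarith

/-- If `φ` is not small on functionals which are small at `e`, then it is not small on some
functional vanishing at `e`. -/
lemma exists_apply_nonpos (hE : HasOrderContinuousNorm (StrongDual ℝ E)) {φ : Bidual E}
    (hφ : 0 ≤ φ) {f : StrongDual ℝ E} (hf : 0 ≤ f) {e : E} (he : 0 ≤ e) {ε : ℝ}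
    (h : ∀ n : ℕ, ∃ g, 0 ≤ g ∧ g ≤ f ∧ 2 ^ n * g e + ε < φ g) (hε : 0 < ε) :
    ∃ g, 0 ≤ g ∧ g ≤ f ∧ g e ≤ 0 ∧ ε ≤ φ g := by
  choose g hg0 hgf hg using h
  have hge : ∀ n, g n e ≤ φ f * (1 / 2) ^ n := fun n => by
    have h1 := (hg n).trans_le (apply_mono hφ (hgf n))
    rw [one_div, inv_pow, ← div_eq_mul_inv, le_div_iff₀ (by positivity)]
    linarith
  have hφf : 0 ≤ φ f := apply_nonneg hφ hf
  -- The witness is the limit superior of the g n: the infimum over k of the suprema s k of the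
  -- tails. Since g n e decays geometrically, s k e tends to 0; and φ (s k) ≥ φ (g k) > ε survives
  -- the infimum by order continuity.
  set S : ℕ → ℕ → StrongDual ℝ E := fun k => partialSups fun n => g (k + n) with hS
  have hSf : ∀ k j, 0 ≤ S k j ∧ S k j ≤ f := fun k j =>
    ⟨(hg0 k).trans (le_partialSups_of_le (fun n => g (k + n)) (Nat.zero_le j)),
      partialSups_le _ _ _ fun i _ => hgf _⟩
  have hSe : ∀ k j, S k j e ≤ φ f * (1 / 2) ^ k * (2 - (1 / 2) ^ j) := by
    intro k j
    induction j with
    | zero =>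
      have h1 := hge k
      simp only [hS, partialSups_zero, add_zero, pow_zero]
      linarith
    | succ j ih =>
      have h1 : S k (j + 1) ≤ S k j + g (k + (j + 1)) := by
        rw [hS]
        simp only
        rw [partialSups_add_one]
        exact sup_le (le_add_of_nonneg_right (hg0 _)) (le_add_of_nonneg_left (hSf k j).1)
      have h2 := h1 e he
      rw [add_apply] at h2
      have h3 := hge (k + (j + 1))
      rw [pow_add, pow_succ] at h3
      rw [pow_succ]
      nlinarith
  have hsup : ∀ k, ∃ s, IsLUB (Set.range (S k)) s ∧
      ∀ (φ : Bidual E) (ε : ℝ), 0 < ε → ∃ d ∈ Set.range (S k), φ s < φ d + ε := fun k =>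
    exists_isLUB_of_directed' hE (Set.range_nonempty _)
      (directedOn_range.2 ((partialSups _).monotone.directed_le)) f
      (by rintro _ ⟨j, rfl⟩; exact hSf k j)
  choose s hs hsφ using hsup
  have hgs : ∀ k n, k ≤ n → g n ≤ s k := fun k n hkn => by
    obtain ⟨j, rfl⟩ := Nat.exists_eq_add_of_le hkn
    exact (le_partialSups (fun n => g (k + n)) j).trans ((hs k).1 ⟨j, rfl⟩)
  have hse : ∀ k, s k e ≤ φ f * (1 / 2) ^ k * 2 := fun k => by
    refine le_of_forall_pos_lt_add fun η hη => ?_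
    obtain ⟨_, ⟨j, rfl⟩, h⟩ := hsφ k (incl E e) η hη
    have h1 : s k e < S k j e + η := h
    have h2 := hSe k j
    have h3 : 0 ≤ φ f * (1 / 2) ^ k * (1 / 2) ^ j := by positivity
    nlinarith
  have hanti : Antitone s := antitone_nat_of_succ_le fun k => by
    refine (hs (k + 1)).2 ?_
    rintro _ ⟨j, rfl⟩
    exact partialSups_le _ _ _ fun i _ => hgs _ _ (by omega)
  have hs0 : ∀ k, 0 ≤ s k := fun k => (hg0 k).trans (hgs k k le_rfl)
  have hsf : ∀ k, s k ≤ f := fun k => (hs k).2 (by rintro _ ⟨j, rfl⟩; exact (hSf k j).2)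
  obtain ⟨u, hu, huφ⟩ := exists_isGLB_of_directed hE (D := Set.range s) (Set.range_nonempty _)
    (directedOn_range.2 (hanti.directed_ge)) f
    (by rintro _ ⟨k, rfl⟩; exact ⟨hs0 k, hsf k⟩)
  refine ⟨u, hu.2 (by rintro _ ⟨k, rfl⟩; exact hs0 k), (hu.1 ⟨0, rfl⟩).trans (hsf 0), ?_, ?_⟩
  · have hlim : Filter.Tendsto (fun k : ℕ => φ f * (1 / 2) ^ k * 2) Filter.atTop (nhds 0) := by
      have h1 := tendsto_pow_atTop_nhds_zero_of_lt_one (r := (1 / 2 : ℝ)) (by norm_num)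
        (by norm_num)
      simpa using (h1.const_mul (φ f)).mul_const 2
    exact ge_of_tendsto' hlim fun k => (hu.1 ⟨k, rfl⟩ e he).trans (hse k)
  · refine le_of_forall_pos_lt_add fun η hη => ?_
    obtain ⟨_, ⟨k, rfl⟩, h⟩ := huφ φ η hη
    have h1 := apply_mono hφ (hgs k k le_rfl)
    have h2 := hg k
    have h3 : 0 ≤ 2 ^ k * g k e := mul_nonneg (by positivity) (apply_nonneg (hg0 k) he)
    linarith

/-- If the norm of the dual is order continuous, then positive bidual elements are approximately
dominated by elements of the space on each order interval of the dual. -/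
lemma exists_approx_dominated (hE : HasOrderContinuousNorm (StrongDual ℝ E)) {φ : Bidual E}
    (hφ : 0 ≤ φ) {f : StrongDual ℝ E} (hf : 0 ≤ f) {ε : ℝ} (hε : 0 < ε) :
    ∃ e : E, 0 ≤ e ∧ ∀ g, 0 ≤ g → g ≤ f → φ g ≤ g e + ε := by
  by_contra! hcon
  -- The supremum s e of the functionals in [0, f] vanishing at e again vanishes at e and has φ (s
  -- e) ≥ ε. As e grows, s e decreases to some u ≤ 0, and order continuity forces φ (s e) < ε for
  -- some e.
  let N : E → Set (StrongDual ℝ E) := fun e => {g | 0 ≤ g ∧ g ≤ f ∧ g e ≤ 0}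
  have hN : ∀ e : E, 0 ≤ e → ∃ s, IsLUB (N e) s ∧ s e ≤ 0 ∧ ε ≤ φ s ∧ 0 ≤ s ∧ s ≤ f := by
    intro e he
    obtain ⟨s, hs, hsφ⟩ := exists_isLUB_of_directed' hE (D := N e) ⟨0, le_rfl, hf, by simp⟩
      (by
        rintro a ⟨ha0, haf, hae⟩ b ⟨hb0, hbf, hbe⟩
        refine ⟨a ⊔ b, ⟨ha0.trans le_sup_left, sup_le haf hbf, ?_⟩, le_sup_left, le_sup_right⟩
        have h1 : a ⊔ b ≤ a + b := sup_le (le_add_of_nonneg_right hb0) (le_add_of_nonneg_left ha0)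
        have h2 := h1 e he
        rw [add_apply] at h2
        linarith) f (fun d hd => ⟨hd.1, hd.2.1⟩)
    obtain ⟨g, hg0, hgf, hge, hgφ⟩ := exists_apply_nonpos hE hφ hf he (ε := ε) (fun n => by
      -- Failure of domination by the multiples 2ⁿ e supplies the functionals with rapidly decaying
      -- values at e.
      obtain ⟨g, hg0, hgf, hg⟩ := hcon ((2 : ℝ) ^ n • e) (smul_nonneg (by positivity) he)
      rw [map_smul, smul_eq_mul] at hg
      exact ⟨g, hg0, hgf, hg⟩) hε
    refine ⟨s, hs, ?_, hgφ.trans (apply_mono hφ (hs.1 ⟨hg0, hgf, hge⟩)),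
      hs.1 ⟨le_rfl, hf, by simp⟩, hs.2 fun d hd => hd.2.1⟩
    refine le_of_forall_pos_lt_add fun η hη => ?_
    obtain ⟨d, hd, h⟩ := hsφ (incl E e) η hη
    have h1 : s e < d e + η := h
    linarith [hd.2.2]
  choose! s hs hse hsφ hs0 hsf using hN
  have hanti : ∀ a b : E, 0 ≤ a → a ≤ b → s b ≤ s a := fun a b ha hab => by
    refine (hs b (ha.trans hab)).2 fun g hg => (hs a ha).1 ⟨hg.1, hg.2.1, ?_⟩
    exact (apply_mono hg.1 hab).trans hg.2.2
  obtain ⟨u, hu, huφ⟩ := exists_isGLB_of_directed hE (D := s '' Set.Ici 0) ⟨_, 0, le_rfl, rfl⟩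
    (by
      rintro _ ⟨a, ha, rfl⟩ _ ⟨b, hb, rfl⟩
      have ha' : (0 : E) ≤ a := ha
      have hb' : (0 : E) ≤ b := hb
      exact ⟨_, ⟨a + b, add_nonneg ha' hb', rfl⟩, hanti _ _ ha' (le_add_of_nonneg_right hb'),
        hanti _ _ hb' (le_add_of_nonneg_left ha')⟩) f
    (by rintro _ ⟨a, ha, rfl⟩; exact ⟨hs0 a ha, hsf a ha⟩)
  have hu0 : u ≤ 0 := fun e he => (hu.1 ⟨e, he, rfl⟩ e he).trans (hse e he)
  obtain ⟨_, ⟨e, he, rfl⟩, h⟩ := huφ φ ε hε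
  have h1 := apply_mono hφ hu0
  rw [map_zero] at h1
  linarith [hsφ e he]

/-- If the norm of the dual is order continuous, then `E` is dense in its bidual for the absolute
weak-star topology. -/
theorem exists_abs_sub_incl_apply_lt (hE : HasOrderContinuousNorm (StrongDual ℝ E)) (φ : Bidual E)
    {f : StrongDual ℝ E} (hf : 0 ≤ f) {ε : ℝ} (hε : 0 < ε) : ∃ t : E, |φ - incl E t| f < ε := by
  have hpos : ∀ (φ : Bidual E), 0 ≤ φ → ∀ ε : ℝ, 0 < ε → ∃ t : E, |φ - incl E t| f < ε := by
    intro φ hφ ε hε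
    obtain ⟨e, he, hφe⟩ := exists_approx_dominated hE hφ hf (ε := ε / 4) (by positivity)
    have he' : 0 ≤ incl E e := (map_zero (incl E)).symm.trans_le (incl_mono he)
    obtain ⟨n, hn⟩ : ∃ n : ℕ, (1 / 2 : ℝ) ^ n * f e < ε / 4 := by
      have h1 := tendsto_pow_atTop_nhds_zero_of_lt_one (r := (1 / 2 : ℝ)) (by norm_num)
        (by norm_num)
      have h2 := h1.mul_const (f e)
      rw [zero_mul] at h2
      exact (h2.eventually (gt_mem_nhds (by positivity))).exists
    obtain ⟨t, ht⟩ := exists_approx_of_le_incl f hf n e (φ ⊓ incl E e) he (le_inf hφ he')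
      inf_le_right (ε / 4) (by positivity)
    refine ⟨t, ?_⟩
    have h1 : |φ - φ ⊓ incl E e| f ≤ ε / 4 := by
      rw [sub_inf φ _ φ, sub_self φ, sup_comm 0 _, abs_of_nonneg le_sup_right]
      refine sup_zero_apply_le_of_forall _ hf fun g hg0 hgf => ?_
      change φ g - g e ≤ _
      linarith [hφe g hg0 hgf]
    have h2 : |φ - incl E t| ≤ |φ - φ ⊓ incl E e| + |φ ⊓ incl E e - incl E t| := by
      refine le_of_eq_of_le ?_ (abs_add_le (φ - φ ⊓ incl E e) (φ ⊓ incl E e - incl E t))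
      rw [sub_add_sub_cancel φ _ _]
    have h3 := h2 f hf
    rw [add_apply] at h3
    linarith
  obtain ⟨a, ha⟩ := hpos φ⁺ (posPart_nonneg φ) (ε / 2) (by positivity)
  obtain ⟨b, hb⟩ := hpos φ⁻ (negPart_nonneg φ) (ε / 2) (by positivity)
  refine ⟨a - b, ?_⟩
  have h1 : φ - incl E (a - b) = (φ⁺ - incl E a) - (φ⁻ - incl E b) := by
    rw [map_sub]
    conv_lhs => rw [← posPart_sub_negPart φ]
    abel
  have h2 : |φ - incl E (a - b)| ≤ |φ⁺ - incl E a| + |φ⁻ - incl E b| := by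
    rw [h1, sub_eq_add_neg (φ⁺ - incl E a) _, ← abs_neg (φ⁻ - incl E b)]
    exact abs_add_le _ _
  have h3 := h2 f hf
  rw [add_apply] at h3
  linarith

end DualLattice

/-! ### Riesz multimorphisms and Aron-Berner extensions -/

/-- The modulus identity already makes A positive, so A = A - 0 witnesses regularity. -/
lemma MultilinearMap.isRieszMultimorphism_of_abs_map {ι : Type*} {E : ι → Type u} {F : Type v}
    [∀ i, AddCommGroup (E i)] [∀ i, Module ℝ (E i)] [∀ i, Lattice (E i)]
    [∀ i, IsOrderedAddMonoid (E i)]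
    [AddCommGroup F] [Module ℝ F] [Lattice F] [IsOrderedAddMonoid F] {A : MultilinearMap ℝ E F}
    (h : ∀ x, |A x| = A (fun i => |x i|)) : A.IsRieszMultimorphism where
  regular := by
    refine ⟨A, 0, fun x hx => ?_, fun x _ => le_rfl, (sub_zero A).symm⟩
    have h1 : (fun i => |x i|) = x := funext fun i => abs_of_nonneg (hx i)
    have h2 := h x
    rw [h1] at h2
    rw [← h2]
    exact abs_nonneg _
  abs_map := h

namespace DualLattice

section

variable {E : Type u} [NormedAddCommGroup E] [NormedSpace ℝ E] [Lattice E] [IsBanachLattice E]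
  {Y : Type v} [NormedAddCommGroup Y] [NormedSpace ℝ Y] [Lattice Y] [IsBanachLattice Y]

/-- If `t ↦ S · t` from `E` to `Y*` has modulus `T` in the sense `|S · t| = T · |t|`, then so does
its extension to the bidual at every element which is approximable by elements of `E`. -/
lemma abs_comp_eq {S T : Y →L[ℝ] StrongDual ℝ E}
    (h : ∀ t : E, |(incl E t) ∘L S| = (incl E |t|) ∘L T) (φ : Bidual E)
    (hφ : ∀ f : StrongDual ℝ E, 0 ≤ f → ∀ ε : ℝ, 0 < ε → ∃ t : E, |φ - incl E t| f < ε) :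
    |φ ∘L S| = |φ| ∘L T := by
  have hT : ∀ y, 0 ≤ y → 0 ≤ T y := fun y hy t ht => by
    have h1 := apply_nonneg (abs_nonneg ((incl E t) ∘L S)) hy
    rw [h t, abs_of_nonneg ht] at h1
    exact h1
  have hST : ∀ z y : Y, |z| ≤ y → |S z| ≤ T y := fun z y hzy t ht => by
    refine abs_apply_le_of_forall _ ht fun w hw => ?_
    have h1 := le_abs_apply ((incl E w) ∘L S) hzy
    rw [h w] at h1
    exact h1.trans (apply_mono (hT y ((abs_nonneg z).trans hzy)) hw)
  -- This half holds for every θ, without approximation. It also controls the error when φ is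
  -- replaced by t.
  have hle : ∀ θ : Bidual E, |θ ∘L S| ≤ |θ| ∘L T := fun θ y hy =>
    abs_apply_le_of_forall _ hy fun z hz => le_abs_apply θ (hST z y hz)
  refine le_antisymm (hle φ) fun y hy => le_of_forall_pos_lt_add fun ε hε => ?_
  -- φ is exchanged for t on both sides of the identity; each exchange costs |φ - incl t| (T y),
  -- hence ε / 2.
  obtain ⟨t, ht⟩ := hφ (T y) (hT y hy) (ε / 2) (by positivity)
  have h1 : |φ| ≤ |incl E t| + |φ - incl E t| := by
    refine le_of_eq_of_le ?_ (abs_add_le (incl E t) (φ - incl E t))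
    rw [add_sub_cancel (incl E t) φ]
  have h2 : |incl E t| (T y) ≤ |(incl E t) ∘L S| y := by
    rw [h t]
    exact abs_incl_le t _ (hT y hy)
  have h3 : |(incl E t) ∘L S| ≤ |φ ∘L S| + |(incl E t - φ) ∘L S| := by
    refine le_of_eq_of_le ?_ (abs_add_le (φ ∘L S) ((incl E t - φ) ∘L S))
    rw [← ContinuousLinearMap.add_comp, add_sub_cancel φ (incl E t)]
  have h4 := hle (incl E t - φ) y hy
  rw [abs_sub_comm (incl E t) φ] at h4
  have h5 := h1 (T y) (hT y hy)
  have h6 := h3 y hy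
  rw [add_apply] at h5 h6
  change |(incl E t - φ) ∘L S| y ≤ |φ - incl E t| (T y) at h4
  change |φ| (T y) < _
  linarith

end

end DualLattice

/-! ### Extending the variables one at a time -/

namespace AronBerner

/-- The partial form in the first variable, the others being fixed. -/
noncomputable def slice {m : ℕ} {E : Fin (m + 1) → Type u} [∀ i, NormedAddCommGroup (E i)]
    [∀ i, NormedSpace ℝ (E i)] (x : ∀ i : Fin m, E i.succ) :
    ContinuousMultilinearMap ℝ E ℝ →L[ℝ] StrongDual ℝ (E 0) :=
  (ContinuousMultilinearMap.apply ℝ (fun i : Fin m => E i.succ) (StrongDual ℝ (E 0)) x) ∘L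
    (ContinuousLinearMap.flipMultilinearEquiv ℝ (fun i : Fin m => E i.succ) (E 0) ℝ :
      (E 0 →L[ℝ] ContinuousMultilinearMap ℝ (fun i : Fin m => E i.succ) ℝ) →L[ℝ]
        ContinuousMultilinearMap ℝ (fun i : Fin m => E i.succ) (E 0 →L[ℝ] ℝ)) ∘L
    ((continuousMultilinearCurryLeftEquiv ℝ E ℝ).toContinuousLinearEquiv :
      ContinuousMultilinearMap ℝ E ℝ →L[ℝ]
        (E 0 →L[ℝ] ContinuousMultilinearMap ℝ (fun i : Fin m => E i.succ) ℝ))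

lemma slice_apply {m : ℕ} {E : Fin (m + 1) → Type u} [∀ i, NormedAddCommGroup (E i)]
    [∀ i, NormedSpace ℝ (E i)] (x : ∀ i : Fin m, E i.succ) (B : ContinuousMultilinearMap ℝ E ℝ)
    (t : E 0) : slice x B t = B (Fin.cons t x) := rfl

lemma step_apply_eq_slice {m : ℕ} {E : Fin (m + 1) → Type u} [∀ i, NormedAddCommGroup (E i)]
    [∀ i, NormedSpace ℝ (E i)] (φ : Bidual (E 0)) (B : ContinuousMultilinearMap ℝ E ℝ)
    (x : ∀ i : Fin m, E i.succ) : step φ B x = φ (slice x B) := rfl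

open DualLattice in
/-- The extension of families of multilinear forms preserves moduli. -/
theorem abs_extend_comp {Y : Type v} [NormedAddCommGroup Y] [NormedSpace ℝ Y] [Lattice Y]
    [IsBanachLattice Y] (m : ℕ) : ∀ (E : Fin m → Type u) [∀ i, NormedAddCommGroup (E i)]
    [∀ i, NormedSpace ℝ (E i)] [∀ i, Lattice (E i)] [∀ i, IsBanachLattice (E i)]
    (_ : ∀ i, HasOrderContinuousNorm (StrongDual ℝ (E i)))
    (B C : Y →L[ℝ] ContinuousMultilinearMap ℝ E ℝ)
    (_ : ∀ x : ∀ i, E i, |(ContinuousMultilinearMap.apply ℝ E ℝ x) ∘L B| =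
      (ContinuousMultilinearMap.apply ℝ E ℝ (fun i => |x i|)) ∘L C)
    (φ : ∀ i, Bidual (E i)), |(extend m E φ) ∘L B| = (extend m E (fun i => |φ i|)) ∘L C := by
  induction m with
  | zero =>
    intro E _ _ _ _ _ B C h φ
    have h1 := h 0
    have h2 : (fun i => |(0 : ∀ i, E i) i|) = 0 := funext fun i => i.elim0
    rw [h2] at h1
    exact h1
  | succ m ih =>
    intro E _ _ _ _ hE B C h φ
    -- After one step the two families differ even if B = C, since one is extended by φ 0 and the
    -- other by |φ 0|; hence the induction runs over pairs.
    refine ih (fun i => E i.succ) (fun i => hE i.succ) ((step (φ 0)) ∘L B) ((step |φ 0|) ∘L C)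
      (fun x => ?_) (fun i => φ i.succ)
    refine abs_comp_eq (S := (slice x) ∘L B) (T := (slice fun i => |x i|) ∘L C) (fun t => ?_) (φ 0)
      fun f hf ε hε => exists_abs_sub_incl_apply_lt (hE 0) (φ 0) hf hε
    have h1 := h (Fin.cons t x)
    have h2 : (fun i => |(Fin.cons t x : ∀ i, E i) i|) = Fin.cons |t| fun i => |x i| := by
      funext i
      refine Fin.cases ?_ (fun j => ?_) i <;> simp
    rw [h2] at h1
    exact h1

lemma reindex_apply' {m : ℕ} {E : Fin m → Type u} [∀ i, NormedAddCommGroup (E i)]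
    [∀ i, NormedSpace ℝ (E i)] {F : Type v} [NormedAddCommGroup F] [NormedSpace ℝ F]
    (ρ : Equiv.Perm (Fin m)) (A : ContinuousMultilinearMap ℝ E F) (x : ∀ j, E (ρ j)) :
    ∃ z : ∀ i, E i, (∀ j, z (ρ j) = x j) ∧ reindex ρ A x = A z := by
  refine ⟨Equiv.piCongrLeft E ρ x, fun j => Equiv.piCongrLeft_apply_apply E ρ x j, ?_⟩
  rw [← reindex_apply ρ A]
  congr 1
  funext j
  exact (Equiv.piCongrLeft_apply_apply E ρ x j).symm

end AronBerner

open DualLattice in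
-- Here Y = F* and both families are y ↦ y ∘ A with permuted variables. The required identity at
-- points of the Eᵢ says that the canonical embedding of F preserves the modulus of A x.
theorem abs_aronBerner {m : ℕ} {E : Fin m → Type u} {F : Type v}
    [∀ i, NormedAddCommGroup (E i)] [∀ i, NormedSpace ℝ (E i)] [∀ i, Lattice (E i)]
    [∀ i, IsBanachLattice (E i)]
    [NormedAddCommGroup F] [NormedSpace ℝ F] [Lattice F] [IsBanachLattice F]
    (hE : ∀ i, HasOrderContinuousNorm (StrongDual ℝ (E i))) (A : ContinuousMultilinearMap ℝ E F)
    (hA : ∀ x : ∀ i, E i, |A x| = A (fun i => |x i|)) (ρ : Equiv.Perm (Fin m))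
    (φ : ∀ i, Bidual (E i)) : |aronBerner ρ A φ| = aronBerner ρ A (fun i => |φ i|) := by
  refine AronBerner.abs_extend_comp m (fun j => E (ρ j)) (fun j => hE (ρ j)) _ _ (fun x => ?_)
    (fun j => φ (ρ j))
  obtain ⟨z, hz, h⟩ := AronBerner.reindex_apply' ρ A x
  have h1 := abs_incl (A z)
  rw [hA, ← h, ← AronBerner.reindex_apply ρ A (fun i => |z i|)] at h1
  simp only [hz] at h1
  exact h1

/-! ### Real-valued Riesz multimorphisms -/

/-- ψ vanishes on the kernel of h, hence is a multiple of h. -/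
lemma LinearMap.exists_eq_mul_of_abs_le {V : Type*} [AddCommGroup V] [Module ℝ V]
    (ψ h : V →ₗ[ℝ] ℝ) (hle : ∀ t, |ψ t| ≤ |h t|) : ∃ c : ℝ, |c| ≤ 1 ∧ ∀ t, ψ t = c * h t := by
  by_cases h0 : ∀ t, h t = 0
  · refine ⟨0, by simp, fun t => ?_⟩
    have := hle t
    rw [h0 t, abs_zero] at this
    rw [zero_mul]
    exact abs_nonpos_iff.1 this
  · push Not at h0
    obtain ⟨a, ha⟩ := h0
    refine ⟨ψ a / h a, ?_, fun t => ?_⟩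
    · rw [abs_div]
      exact div_le_one_of_le₀ (hle a) (abs_nonneg _)
    · have h1 := hle (t - (h t / h a) • a)
      simp only [map_sub, map_smul, smul_eq_mul, div_mul_cancel₀ _ ha, sub_self, abs_zero] at h1
      have h2 := sub_eq_zero.1 (abs_nonpos_iff.1 h1)
      rw [h2]
      ring

instance Real.instIsBanachLattice : IsBanachLattice ℝ where

lemma abs_update {ι : Type*} [DecidableEq ι] {E : ι → Type u} [∀ i, AddCommGroup (E i)]
    [∀ i, Lattice (E i)] (x : ∀ i, E i) (i : ι) (t : E i) :
    (fun j => |Function.update x i t j|) = Function.update (fun j => |x j|) i |t| := by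
  funext j
  by_cases hj : j = i
  · subst hj; simp
  · simp [hj]

namespace MultilinearMap

variable {ι : Type*} [Fintype ι] [DecidableEq ι] {E : ι → Type u}
  [∀ i, NormedAddCommGroup (E i)] [∀ i, NormedSpace ℝ (E i)] [∀ i, Lattice (E i)]
  [∀ i, IsBanachLattice (E i)]

/-- Partial functionals of a real-valued Riesz multimorphism are proportional. -/
lemma mul_eq_mul_update {φ : MultilinearMap ℝ E ℝ} (hφ : ∀ x, |φ x| = φ (fun i => |x i|))
    (x a : ∀ i, E i) (i : ι) :
    φ x * φ a = φ (Function.update x i (a i)) * φ (Function.update a i (x i)) := by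
  have hpos : φ.IsPositive := fun z hz => by
    have h1 : (fun i => |z i|) = z := funext fun i => abs_of_nonneg (hz i)
    rw [← h1, ← hφ]
    exact abs_nonneg _
  -- w dominates both |x| and |a|, so the partial functionals in variable i at x and at a are both
  -- multiples of the one at w. The two sides of the identity then agree by symmetry.
  set w : ∀ i, E i := fun j => |x j| + |a j| with hw
  have hw0 : ∀ j, 0 ≤ w j := fun j => add_nonneg (abs_nonneg _) (abs_nonneg _)
  have key : ∀ z : ∀ i, E i, (∀ j, |z j| ≤ w j) →
      ∃ c : ℝ, ∀ t, φ (Function.update z i t) = c * φ (Function.update w i t) := by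
    intro z hz
    obtain ⟨c, -, hc⟩ := LinearMap.exists_eq_mul_of_abs_le (φ.toLinearMap z i) (φ.toLinearMap w i)
      (fun t => by
        simp only [toLinearMap_apply]
        rw [hφ, hφ, abs_update, abs_update]
        refine hpos.mono (fun j => ?_) fun j => ?_
        · rw [← abs_update]; exact abs_nonneg _
        · by_cases hj : j = i
          · subst hj; simp
          · simpa [hj] using (hz j).trans (le_abs_self _))
    exact ⟨c, hc⟩
  obtain ⟨c, hc⟩ := key x fun j => le_add_of_nonneg_right (abs_nonneg _)
  obtain ⟨d, hd⟩ := key a fun j => le_add_of_nonneg_left (abs_nonneg _)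
  have h1 := hc (x i)
  have h2 := hd (a i)
  rw [Function.update_eq_self] at h1 h2
  rw [h1, h2, hc, hd]
  ring

/-- Real-valued Riesz multimorphisms are products of Riesz homomorphisms. -/
theorem exists_eq_prod {φ : MultilinearMap ℝ E ℝ} (hφ : ∀ x, |φ x| = φ (fun i => |x i|)) :
    ∃ (c : ℝ) (h : ∀ i, StrongDual ℝ (E i)), 0 ≤ c ∧ (∀ i t, |h i t| = h i |t|) ∧
      ∀ x, φ x = c * ∏ i, h i (x i) := by
  by_cases h0 : ∀ x, φ x = 0
  · exact ⟨0, 0, le_rfl, by simp, by simp [h0]⟩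
  push Not at h0
  obtain ⟨b, hb⟩ := h0
  obtain ⟨a, ha, hφa⟩ : ∃ a : ∀ i, E i, (∀ i, 0 ≤ a i) ∧ 0 < φ a :=
    ⟨fun i => |b i|, fun i => abs_nonneg _, by rw [← hφ]; exact abs_pos.2 hb⟩
  have haa : (fun i => |a i|) = a := funext fun i => abs_of_nonneg (ha i)
  have hreg := (isRieszMultimorphism_of_abs_map hφ).regular
  -- The partial functional at a positive point a with φ a > 0, normalized so that h i (a i) = 1.
  let h : ∀ i, StrongDual ℝ (E i) := fun i =>
    (φ a)⁻¹ • hreg.toContinuous.toContinuousLinearMap a i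
  have hh : ∀ i t, h i t = (φ a)⁻¹ * φ (Function.update a i t) := fun i t => rfl
  refine ⟨φ a, h, hφa.le, fun i t => ?_, fun x => ?_⟩
  · rw [hh, hh, abs_mul, hφ, abs_update, haa, abs_of_pos (inv_pos.2 hφa)]
  -- The coordinates of x are exchanged for those of a one at a time, each at the price of a factor
  -- φ a on the left.
  · have key : ∀ s : Finset ι, φ x * φ a ^ s.card =
        φ (s.piecewise a x) * ∏ i ∈ s, φ (Function.update a i (x i)) := by
      intro s
      induction s using Finset.induction_on with
      | empty => simp
      | insert j s hj ih =>
        rw [Finset.card_insert_of_notMem hj, Finset.prod_insert hj, pow_succ, ← mul_assoc, ih,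
          mul_right_comm, mul_eq_mul_update hφ (s.piecewise a x) a j, Finset.piecewise_insert,
          Finset.piecewise_eq_of_notMem _ _ _ hj, mul_assoc]
    have h1 := key Finset.univ
    have h2 : ∀ i, φ (Function.update a i (x i)) = φ a * h i (x i) := fun i => by
      rw [hh, mul_inv_cancel_left₀ hφa.ne']
    simp only [Finset.piecewise_univ, h2, Finset.prod_mul_distrib, Finset.prod_const] at h1
    refine mul_right_cancel₀ (pow_ne_zero (Finset.univ : Finset ι).card hφa.ne') ?_
    rw [h1]
    ring

end MultilinearMap

/-! ### Finite rank Riesz multimorphisms -/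

/-- The dual basis of the span, extended linearly to all of F so that it can be composed with A.
Continuity is not needed. -/
lemma exists_coordinate_functionals {F : Type v} [AddCommGroup F] [Module ℝ F] (s : Finset F)
    (hs : LinearIndependent ℝ (fun g : s => (g : F))) :
    ∃ l : s → F →ₗ[ℝ] ℝ, (∀ v ∈ Submodule.span ℝ (s : Set F), v = ∑ g : s, l g v • (g : F)) ∧
      ∀ c : s → ℝ, ∀ g, l g (∑ k : s, c k • (k : F)) = c g := by
  classical
  let b := Module.Basis.span hs
  choose l hl using fun g : s => LinearMap.exists_extend (b.coord g)
  have hl' : ∀ g (v : Submodule.span ℝ (Set.range fun g : s => (g : F))), l g v = b.repr v g :=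
    fun g v => LinearMap.congr_fun (hl g) v
  refine ⟨l, fun v hv => ?_, fun c g => ?_⟩
  · have hv' : v ∈ Submodule.span ℝ (Set.range fun g : s => (g : F)) := by simpa using hv
    have h1 := congrArg Subtype.val (b.sum_repr ⟨v, hv'⟩)
    simp only [Submodule.coe_sum, Submodule.coe_smul] at h1
    refine h1.symm.trans (Finset.sum_congr rfl fun g _ => ?_)
    rw [← hl', Module.Basis.span_apply]
  · have h1 : ∀ k : s, l g (k : F) = if k = g then 1 else 0 := fun k => by
      have h2 := hl' g (b k)
      rw [b.repr_self, Finsupp.single_apply, Module.Basis.span_apply] at h2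
      exact h2
    simp [h1]

section

variable {m : ℕ} {E : Fin m → Type u} {F : Type v}
  [∀ i, NormedAddCommGroup (E i)] [∀ i, NormedSpace ℝ (E i)] [∀ i, Lattice (E i)]
  [∀ i, IsBanachLattice (E i)]
  [NormedAddCommGroup F] [NormedSpace ℝ F] [Lattice F] [IsBanachLattice F]

/-- Finite rank Riesz multimorphisms are finite sums of products of Riesz homomorphisms with
pairwise disjoint positive coefficients. -/
theorem MultilinearMap.IsRieszMultimorphism.exists_eq_sum_prod {A : MultilinearMap ℝ E F}
    (hA : A.IsRieszMultimorphism) (hfin : A.HasFiniteRank) :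
    ∃ (s : Finset F) (c : s → ℝ) (h : s → ∀ i, StrongDual ℝ (E i)),
      (∀ g : s, (0 : F) ≤ g) ∧ (∀ g k : s, g ≠ k → (g : F) ⊓ k = 0) ∧ (∀ g, 0 ≤ c g) ∧
      (∀ g i t, |h g i t| = h g i |t|) ∧
      ∀ x, A x = ∑ g : s, (c g * ∏ i, h g i (x i)) • (g : F) := by
  have : FiniteDimensional ℝ (rieszSpan (Set.range A)) := hfin
  obtain ⟨s, hpos, hdis, hspan⟩ :=
    VectorLattice.exists_disjoint_le_span (rieszSpan (Set.range A)) (rieszSpan_sup_inf_mem _)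
  have hdis' : ∀ g k : s, g ≠ k → (g : F) ⊓ k = 0 := fun g k hgk =>
    hdis g g.2 k k.2 fun h => hgk (Subtype.ext h)
  obtain ⟨l, hl, hlc⟩ := exists_coordinate_functionals s
    (VectorLattice.linearIndependent_of_disjoint (fun g : s => hpos g g.2) hdis')
  have hAl : ∀ x, A x = ∑ g : s, l g (A x) • (g : F) := fun x =>
    hl _ (hspan (subset_rieszSpan _ ⟨x, rfl⟩))
  -- By disjointness the coordinates of |A x| are the moduli of the coordinates of A x.
  have hφ : ∀ (g : s) x, |(l g).compMultilinearMap A x| =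
      (l g).compMultilinearMap A (fun i => |x i|) := fun g x => by
    simp only [LinearMap.compMultilinearMap_apply]
    rw [← hA.abs_map]
    conv_rhs => rw [hAl x, VectorLattice.abs_sum_smul_of_disjoint Finset.univ _
      (fun g : s => (hpos g g.2).le) hdis']
    rw [hlc]
  choose c h hc hh hprod using fun g => MultilinearMap.exists_eq_prod (hφ g)
  refine ⟨s, c, h, fun g => (hpos g g.2).le, hdis', hc, hh, fun x => ?_⟩
  rw [hAl x]
  exact Finset.sum_congr rfl fun g _ => by rw [← hprod]; rfl

end

namespace AronBerner

/-- Extending the first variable replaces the factor h k 0 (x₀) by the scalar φ 0 (h k 0), which is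
absorbed into c k. This is why the coefficients are arbitrary. -/
lemma extend_eq_sum_prod {κ : Type*} [Fintype κ] (m : ℕ) : ∀ (E : Fin m → Type u)
    [∀ i, NormedAddCommGroup (E i)] [∀ i, NormedSpace ℝ (E i)] (c : κ → ℝ)
    (h : κ → ∀ i, StrongDual ℝ (E i)) (B : ContinuousMultilinearMap ℝ E ℝ)
    (_ : ∀ x, B x = ∑ k, c k * ∏ i, h k i (x i)) (φ : ∀ i, Bidual (E i)),
    extend m E φ B = ∑ k, c k * ∏ i, φ i (h k i) := by
  induction m with
  | zero =>
    intro E _ _ c h B hB φ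
    rw [extend_zero, hB]
    simp
  | succ m ih =>
    intro E _ _ c h B hB φ
    rw [extend_succ, ih (fun i => E i.succ) (fun k => c k * φ 0 (h k 0))
      (fun k i => h k i.succ) (step (φ 0) B) (fun x => ?_) (fun i => φ i.succ)]
    · exact Finset.sum_congr rfl fun k _ => by rw [Fin.prod_univ_succ, mul_assoc]
    · have h1 : slice x B = ∑ k, (c k * ∏ i, h k i.succ (x i)) • h k 0 := by
        ext t
        rw [slice_apply, hB, sum_apply]
        refine Finset.sum_congr rfl fun k _ => ?_
        rw [Fin.prod_univ_succ]
        simp only [Fin.cons_zero, Fin.cons_succ, smul_apply, smul_eq_mul]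
        ring
      rw [step_apply_eq_slice, h1, map_sum]
      refine Finset.sum_congr rfl fun k _ => ?_
      rw [map_smul, smul_eq_mul]
      ring

end AronBerner

/-! ### Riesz homomorphisms, disjointness and the bidual -/

namespace DualLattice

variable {E : Type u} [NormedAddCommGroup E] [NormedSpace ℝ E] [Lattice E] [IsBanachLattice E]

/-- Evaluation at a Riesz homomorphism is a Riesz homomorphism on the bidual. -/
lemma abs_apply_of_abs_map {h : StrongDual ℝ E} (hh : ∀ t, |h t| = h |t|) (θ : Bidual E) :
    |θ| h = |θ h| := by
  have h0 : 0 ≤ h := fun t ht => by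
    have h1 := hh t
    rw [abs_of_nonneg ht] at h1
    change 0 ≤ h t
    rw [← h1]
    exact abs_nonneg _
  refine le_antisymm (abs_apply_le_of_forall θ h0 fun ψ hψ => ?_) ?_
  -- For a Riesz homomorphism h, |ψ| ≤ h gives |ψ t| ≤ h |t| = |h t|; so the order interval [-h, h]
  -- contains only multiples of h.
  · obtain ⟨c, hc, hψc⟩ := LinearMap.exists_eq_mul_of_abs_le (ψ : E →ₗ[ℝ] ℝ) (h : E →ₗ[ℝ] ℝ)
      (fun t => by
        refine (abs_apply_le ψ t).trans ((hψ _ (abs_nonneg t)).trans_eq ?_)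
        exact (hh t).symm)
    have h1 : ψ = c • h := by ext t; exact hψc t
    rw [h1, map_smul, smul_eq_mul]
    refine (le_abs_self _).trans ?_
    rw [abs_mul]
    exact mul_le_of_le_one_left (abs_nonneg _) hc
  · have h1 := abs_apply_le θ h
    rwa [abs_of_nonneg h0] at h1

/-- Disjointness of positive elements amounts to |a - b| = a + b, an identity preserved by a linear
map that commutes with moduli. -/
lemma incl_inf_incl {a b : E} (h : a ⊓ b = 0) : incl E a ⊓ incl E b = 0 := by
  have ha : 0 ≤ incl E a := (map_zero (incl E)).symm.trans_le (incl_mono (h ▸ inf_le_left))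
  have hb : 0 ≤ incl E b := (map_zero (incl E)).symm.trans_le (incl_mono (h ▸ inf_le_right))
  have h1 := abs_incl (a - b)
  rw [VectorLattice.abs_sub_of_inf_eq_zero h, map_sub, map_add,
    abs_sub_comm (incl E a) (incl E b), ← sup_sub_inf_eq_abs_sub, ← inf_add_sup (incl E a)] at h1
  have h2 : incl E a ⊓ incl E b + incl E a ⊓ incl E b = 0 := by
    have h3 := sub_eq_zero.2 h1.symm
    rw [← h3]
    abel
  have h4 : 0 ≤ incl E a ⊓ incl E b := le_inf ha hb
  exact le_antisymm ((le_add_of_nonneg_left h4).trans h2.le) h4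

end DualLattice

open DualLattice in
-- The right side does not involve ρ, as a product of scalars may be taken in any order. This gives
-- the coincidence of all the extensions.
lemma aronBerner_eq_sum_prod {m : ℕ} {E : Fin m → Type u} {F : Type v}
    [∀ i, NormedAddCommGroup (E i)] [∀ i, NormedSpace ℝ (E i)] [NormedAddCommGroup F]
    [NormedSpace ℝ F] {κ : Type*} [Fintype κ] (A : ContinuousMultilinearMap ℝ E F)
    (c : κ → ℝ) (h : κ → ∀ i, StrongDual ℝ (E i)) (g : κ → F)
    (hA : ∀ x, A x = ∑ k, (c k * ∏ i, h k i (x i)) • g k) (ρ : Equiv.Perm (Fin m))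
    (φ : ∀ i, Bidual (E i)) :
    aronBerner ρ A φ = ∑ k, (c k * ∏ i, φ i (h k i)) • incl F (g k) := by
  ext y
  rw [aronBerner_apply, AronBerner.extend_eq_sum_prod m (fun j => E (ρ j))
    (fun k => c k * y (g k)) (fun k j => h k (ρ j)) _ (fun x => ?_), sum_apply]
  · refine Finset.sum_congr rfl fun k _ => ?_
    rw [Equiv.prod_comp ρ (fun i => φ i (h k i))]
    change _ = (c k * ∏ i, φ i (h k i)) * y (g k)
    ring
  · obtain ⟨z, hz, hAz⟩ := AronBerner.reindex_apply' ρ A x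
    change y (AronBerner.reindex ρ A x) = _
    rw [hAz, hA, map_sum]
    refine Finset.sum_congr rfl fun k _ => ?_
    rw [map_smul, smul_eq_mul, ← Equiv.prod_comp ρ (fun i => h k i (z i))]
    simp only [hz]
    ring

theorem proposition3p4 {m : ℕ} {E : Fin m → Type u} {F : Type v}
    [∀ i, NormedAddCommGroup (E i)] [∀ i, NormedSpace ℝ (E i)] [∀ i, Lattice (E i)]
    [∀ i, IsBanachLattice (E i)]
    [NormedAddCommGroup F] [NormedSpace ℝ F] [Lattice F] [IsBanachLattice F] :
    (∀ (A : MultilinearMap ℝ E F) (hA : A.IsRieszMultimorphism), A.HasFiniteRank →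
      (∀ ρ σ : Equiv.Perm (Fin m),
        aronBerner ρ hA.regular.toContinuous = aronBerner σ hA.regular.toContinuous) ∧
      ∀ ρ : Equiv.Perm (Fin m), MultilinearMap.IsRieszMultimorphism
        (E := fun i => Bidual (E i)) (F := Bidual F) (aronBerner ρ hA.regular.toContinuous)) ∧
    ((∀ i, HasOrderContinuousNorm (StrongDual ℝ (E i))) →
      ∀ (A : MultilinearMap ℝ E F) (hA : A.IsRieszMultimorphism) (ρ : Equiv.Perm (Fin m)),
        MultilinearMap.IsRieszMultimorphism
        (E := fun i => Bidual (E i)) (F := Bidual F) (aronBerner ρ hA.regular.toContinuous)) := by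
  refine ⟨fun A hA hfin => ?_, fun hE A hA ρ =>
    MultilinearMap.isRieszMultimorphism_of_abs_map (abs_aronBerner hE _ hA.abs_map ρ)⟩
  obtain ⟨s, c, h, hpos, hdis, hc, hh, hAs⟩ := hA.exists_eq_sum_prod hfin
  have hAB := aronBerner_eq_sum_prod hA.regular.toContinuous c h (fun g : s => (g : F)) hAs
  refine ⟨fun ρ σ => MultilinearMap.ext fun φ => ?_, fun ρ =>
    MultilinearMap.isRieszMultimorphism_of_abs_map fun φ => ?_⟩
  · rw [hAB ρ φ, hAB σ φ]
  · rw [hAB ρ φ, hAB ρ]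
    refine (VectorLattice.abs_sum_smul_of_disjoint (F := Bidual F)
      (g := fun g : s => DualLattice.incl F g) Finset.univ _ (fun g =>
      (map_zero (DualLattice.incl F)).symm.trans_le (DualLattice.incl_mono (hpos g)))
      fun g k hgk => DualLattice.incl_inf_incl (hdis g k hgk)).trans ?_
    refine Finset.sum_congr rfl fun g _ => ?_
    rw [abs_mul, abs_of_nonneg (hc g), Finset.abs_prod]
    simp only [DualLattice.abs_apply_of_abs_map (hh g _)]
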